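/- **Proposition 3.4 (thickened $E$).** Let $M$ be a compact, orientable, hyperbolizable 3-manifold with incompressible boundary and non-abelian fundamental group, let $T$ be a thickened torus component of its characteristic submanifold $\Sigma(M)$, and let $Fr(T)$ be the frontier of $T$ in $M$, with components the annuli $A_1,\dots,A_n$, $n\ge 1$. View $T$ as an $S^1$-bundle with base surface $(B,b)$: $B=S^1\times[0,1]$ is an annulus with boundary components $\partial_0B=S^1\times\{0\}$ and $\partial_1B=S^1\times\{1\}$, $b=b_1\cup\dots\cup b_n$ is a union of $n$ disjoint embedded arcs in $\partial_1B$, and $(T,Fr(T))=(B\times S^1,\,b\times S^1)$. (The properties of $M$ and $\Sigma(M)$ enter only through this identification: all that follows holds for every compact subset $T$ of a Hausdorff space $M$ with a homeomorphism $T\cong B\times S^1$ that takes the frontier of $T$ in $M$ to $b\times S^1$, $n\ge1$.) *Definitions.* $E(T,Fr(T))$ is the set of path components of the space of homotopy equivalences $T\to T$ that restrict to homeomorphisms of $Fr(T)$ isotopic to the identity, with the product induced by composition. Let $p_1:T\to B$ be the projection and $s:B\to T$, $s(p)=(p,1)$. Let $\beta$ be a core curve of $B$ and, for $1\le j\le n-1$,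 let $\gamma_j$ be a properly embedded arc in $B$ that joins the two components of $\partial_1B-b$ adjacent to $b_j$ and meets $\beta$ in a single point $x_j$. A sweep $h(\gamma_j,\beta):(B,b)\to(B,b)$ is a map that is the identity outside a regular neighbourhood $N_j$ of $\gamma_j$ disjoint from $b$ and that maps a transversal $t=t_1*t_2$ of $N_j$ through $x_j$ (where $t_1$ ends and $t_2$ starts at $x_j$) to $t_1*\beta*t_2$, up to homotopy relative to the endpoints, $\beta$ being regarded as a loop based at $x_j$. Put $H(\gamma_j,\beta)=h(\gamma_j,\beta)\times \mathrm{id}_{S^1}:T\to T$. Such $\{h(\gamma_j,\beta)\}_{j=1}^{n-1}$ are called a generating system of sweeps. A vertical essential annulus is $A=a\times S^1$, where $a$ is a properly embedded arc in $B$ that joins $\partial_0B$ to $\partial_1B$ and is disjoint from $b$. A Dehn twist $D_A$ about $A$ is the map of $T$ that is the identity off $N\times S^1$, where $N\cong a\times[-1,1]$ is a regular neighbourhood of $a$ disjoint from $b$, and that maps $(y,r,w)\in a\times[-1,1]\times S^1$ to $(y,r,e^{i\pi(r+1)}w)$. *Claim.* $E(T,Fr(T))$ is a group. Let $E_0(T,Fr(T))$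 be the set of the classes $[f]$ for which $p_1\circ f\circ s:B\to B$ induces the identity on $\pi_1(B)$. Then $E_0(T,Fr(T))$ is a subgroup of index two in $E(T,Fr(T))$, and it is free abelian of rank $n$. Generating systems of sweeps and Dehn twists about vertical essential annuli exist, and for every generating system of sweeps $\{h(\gamma_j,\beta)\}_{j=1}^{n-1}$ and every Dehn twist $D_A$ about a vertical essential annulus $A$, the group $E_0(T,Fr(T))$ is freely generated, as an abelian group, by the $n$ classes $[H(\gamma_1,\beta)],\dots,[H(\gamma_{n-1},\beta)],[D_A]$. -/

import Mathlib

/-! ## The group of path components of self homotopy equivalences of a pair -/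

/-- `f` is a homotopy equivalence `X → X`. -/
def IsSelfHomotopyEquiv {X : Type*} [TopologicalSpace X] (f : C(X, X)) : Prop :=
  ∃ g : C(X, X), (g.comp f).Homotopic (ContinuousMap.id X) ∧
    (f.comp g).Homotopic (ContinuousMap.id X)

/-- `f` maps `A` to `A`, and its restriction to `A` is a homeomorphism of `A` that is isotopic
to the identity of `A` (the isotopy `F` is a path of homeomorphisms of `A`; it is not required
to fix any point). -/
def RestrictsToIsotopicId {X : Type*} [TopologicalSpace X] (A : Set X) (f : C(X, X)) : Prop :=
  ∃ F : C(unitInterval × A, A), (∀ t, IsHomeomorph fun a : A => F (t, a)) ∧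
    (∀ a, F (0, a) = a) ∧ ∀ a, ((F (1, a) : A) : X) = f a

/-- The space of homotopy equivalences of `X` that restrict to homeomorphisms of `A` isotopic to
the identity. It carries the subspace topology of the compact-open topology of `C(X, X)`. -/
abbrev PairEquivSpace (X : Type*) [TopologicalSpace X] (A : Set X) : Type _ :=
  {f : C(X, X) // IsSelfHomotopyEquiv f ∧ RestrictsToIsotopicId A f}

section PairEquiv

variable {X : Type*} [TopologicalSpace X] {A : Set X}

theorem IsSelfHomotopyEquiv.comp {f g : C(X, X)} (hf : IsSelfHomotopyEquiv f)
    (hg : IsSelfHomotopyEquiv g) : IsSelfHomotopyEquiv (f.comp g) := by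
  obtain ⟨f', h1, h2⟩ := hf
  obtain ⟨g', h3, h4⟩ := hg
  refine ⟨g'.comp f', ?_, ?_⟩
  · have h : ((g'.comp (f'.comp f)).comp g).Homotopic ((g'.comp (ContinuousMap.id X)).comp g) :=
      ((ContinuousMap.Homotopic.refl g').comp h1).comp (ContinuousMap.Homotopic.refl g)
    exact h.trans h3
  · have h : ((f.comp (g.comp g')).comp f').Homotopic ((f.comp (ContinuousMap.id X)).comp f') :=
      ((ContinuousMap.Homotopic.refl f).comp h4).comp (ContinuousMap.Homotopic.refl f')
    exact h.trans h2

theorem RestrictsToIsotopicId.comp {f g : C(X, X)} (hf : RestrictsToIsotopicId A f)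
    (hg : RestrictsToIsotopicId A g) : RestrictsToIsotopicId A (f.comp g) := by
  obtain ⟨F, h1, h2, h3⟩ := hf
  obtain ⟨G, h4, h5, h6⟩ := hg
  refine ⟨⟨fun p => F (p.1, G p), by fun_prop⟩, fun t => (h1 t).comp (h4 t), fun a => ?_,
    fun a => ?_⟩
  · simp [h2, h5]
  · simp [h3, h6]

instance : Mul (PairEquivSpace X A) :=
  ⟨fun f g => ⟨f.1.comp g.1, f.2.1.comp g.2.1, f.2.2.comp g.2.2⟩⟩

instance : One (PairEquivSpace X A) :=
  ⟨⟨ContinuousMap.id X, ⟨ContinuousMap.id X, ContinuousMap.Homotopic.refl _,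
    ContinuousMap.Homotopic.refl _⟩, ⟨⟨fun p => p.2, by fun_prop⟩,
    fun _ => (Homeomorph.refl A).isHomeomorph, fun _ => rfl, fun _ => rfl⟩⟩⟩

/-- Composition of maps. -/
instance : Monoid (PairEquivSpace X A) where
  mul_assoc _ _ _ := rfl
  one_mul _ := rfl
  mul_one _ := rfl

instance [LocallyCompactSpace X] : ContinuousMul (PairEquivSpace X A) where
  continuous_mul := by
    refine Continuous.subtype_mk ?_ _
    exact ContinuousMap.continuous_comp'.comp
      ((continuous_subtype_val.comp continuous_snd).prodMk
        (continuous_subtype_val.comp continuous_fst))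

end PairEquiv

/-- `E(X, A)`: the path components of the space of homotopy equivalences of `X` that restrict to
homeomorphisms of `A` isotopic to the identity. -/
def PairMappingClasses (X : Type*) [TopologicalSpace X] (A : Set X) : Type _ :=
  ZerothHomotopy (PairEquivSpace X A)

namespace PairMappingClasses

variable {X : Type*} [TopologicalSpace X] {A : Set X}

/-- The path component of a map. -/
def mk (f : PairEquivSpace X A) : PairMappingClasses X A :=
  Quotient.mk (pathSetoid (PairEquivSpace X A)) f

/-- The product of `E(X, A)`, induced by composition of maps. -/
instance [LocallyCompactSpace X] : Monoid (PairMappingClasses X A) where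
  mul := Quotient.map₂ (· * ·) fun _ _ h₁ _ _ h₂ => by
    obtain ⟨p⟩ := h₁
    obtain ⟨q⟩ := h₂
    exact ⟨{ toFun := fun t => p t * q t
             continuous_toFun := by fun_prop
             source' := by simp
             target' := by simp }⟩
  one := mk 1
  mul_assoc := by
    rintro ⟨a⟩ ⟨b⟩ ⟨c⟩
    rfl
  one_mul := by
    rintro ⟨a⟩
    rfl
  mul_one := by
    rintro ⟨a⟩
    rfl

/-- `f` belongs to the space of maps that defines `E(X, A)`, and `x` is its class. -/
def IsClassOf (x : PairMappingClasses X A) (f : C(X, X)) : Prop :=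
  ∃ hf : IsSelfHomotopyEquiv f ∧ RestrictsToIsotopicId A f, x = mk ⟨f, hf⟩

end PairMappingClasses

/-! ## The base surface `(B, b)` -/

/-- The annulus `B = S¹ × [0,1]`; its boundary components are `∂₀B = S¹ × {0}` and
`∂₁B = S¹ × {1}`. -/
abbrev BaseAnnulus : Type := Circle × unitInterval

/-- The boundary of the annulus. -/
def BaseAnnulus.bdry : Set BaseAnnulus := {p | p.2 = 0 ∨ p.2 = 1}

/-- `n` pairwise disjoint embedded arcs in the boundary component `∂₁B` of the annulus. (They are
numbered in an arbitrary way.) -/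
structure BoundaryArcs (n : ℕ) where
  /-- The arc `bⱼ` is the image of `arc j`, placed in `∂₁B = S¹ × {1}`. -/
  arc : Fin n → C(unitInterval, Circle)
  arc_injective : ∀ j, Function.Injective (arc j)
  arc_disjoint : ∀ i j, i ≠ j → Disjoint (Set.range (arc i)) (Set.range (arc j))

namespace BoundaryArcs

variable {n : ℕ} (b : BoundaryArcs n)

/-- The union of the arcs, as a subset of the circle `∂₁B`. -/
def union : Set Circle := ⋃ j, Set.range (b.arc j)

/-- The union `b` of the arcs, as a subset of the annulus. -/
def carrier : Set BaseAnnulus := {p | p.2 = 1 ∧ p.1 ∈ b.union}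

/-- The component of `∂₁B - b` that contains `q`. -/
def gap (q : Circle) : Set Circle := connectedComponentIn (b.union)ᶜ q

/-- `γ` is a properly embedded arc in `B` that joins the components of `∂₁B - b` adjacent
to `bⱼ`. (If there are at least two arcs, there are exactly two such components; no arc satisfies
this if there is only one arc.) -/
structure IsArcAround (j : Fin n) (γ : C(unitInterval, BaseAnnulus)) : Prop where
  injective : Function.Injective γ
  mem_bdry_iff : ∀ s, γ s ∈ BaseAnnulus.bdry ↔ s = 0 ∨ s = 1
  start_mem : (γ 0).2 = 1 ∧ (γ 0).1 ∉ b.union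
  end_mem : (γ 1).2 = 1 ∧ (γ 1).1 ∉ b.union
  start_adjacent : (closure (b.gap (γ 0).1) ∩ Set.range (b.arc j)).Nonempty
  end_adjacent : (closure (b.gap (γ 1).1) ∩ Set.range (b.arc j)).Nonempty
  gap_ne : b.gap (γ 0).1 ≠ b.gap (γ 1).1

/-- `ν`, restricted to `[0,1] × [-1,1]`, parametrizes a regular neighbourhood `N` of the properly
embedded arc `γ` in `B`: it is an embedding, `γ` is its core `s ↦ ν (s, 0)`, it meets the boundary
of `B` exactly in `{0,1} × [-1,1]`, and it is disjoint from `b`. (The values of `ν` outside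
`[0,1] × [-1,1]` play no role.) -/
structure IsRegularNhd (γ : C(unitInterval, BaseAnnulus)) (ν : C(unitInterval × ℝ, BaseAnnulus)) :
    Prop where
  injOn : Set.InjOn ν (Set.univ ×ˢ Set.Icc (-1 : ℝ) 1)
  core : ∀ s, ν (s, 0) = γ s
  mem_bdry_iff : ∀ s, ∀ r ∈ Set.Icc (-1 : ℝ) 1, ν (s, r) ∈ BaseAnnulus.bdry ↔ s = 0 ∨ s = 1
  avoids : ∀ s, ∀ r ∈ Set.Icc (-1 : ℝ) 1, ν (s, r) ∉ b.carrier

/-- `h` is a sweep `h(γ, β) : B → B` of the arc `γ` along the loop `β` based at the point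
`x = γ s₀` of `γ`: for some regular neighbourhood `N` of `γ`, the map `h` fixes the complement of
`N` (and hence the frontier of `N`), and it maps the transversal `t = t₁ * t₂` of `N`
through `x` to the path `t₁ * β * t₂`, up to homotopy relative to the endpoints. Here `t` runs
along `r ↦ ν (s₀, r)` from `r = -1` to `r = 1`, and passes through `x` at `r = 0`. -/
def IsSweep (γ : C(unitInterval, BaseAnnulus)) (s₀ : unitInterval) (β : Path (γ s₀) (γ s₀))
    (h : C(BaseAnnulus, BaseAnnulus)) : Prop :=
  ∃ ν : C(unitInterval × ℝ, BaseAnnulus), b.IsRegularNhd γ ν ∧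
    (∀ p ∉ ν '' (Set.univ ×ˢ Set.Ioo (-1 : ℝ) 1), h p = p) ∧
    ∃ (t₁ : Path (ν (s₀, -1)) (γ s₀)) (t₂ : Path (γ s₀) (ν (s₀, 1)))
      (ht : Path (ν (s₀, -1)) (ν (s₀, 1))),
      (∀ r : unitInterval, t₁ r = ν (s₀, (r : ℝ) - 1)) ∧
      (∀ r : unitInterval, t₂ r = ν (s₀, (r : ℝ))) ∧
      (∀ r, ht r = h ((t₁.trans t₂) r)) ∧
      ht.Homotopic ((t₁.trans β).trans t₂)

end BoundaryArcs

/-- The core circle `S¹ × {1/2}` of the annulus, parametrized by `u : S¹ → S¹`. -/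
noncomputable def coreCircle (u : C(Circle, Circle)) : C(Circle, BaseAnnulus) :=
  ⟨fun z => (u z, ⟨1 / 2, by norm_num, by norm_num⟩), by fun_prop⟩

/-- `β` is a core curve of the annulus: a simple closed curve in the interior of `B` that is freely
homotopic to `S¹ × {1/2}`, with one of its two orientations. -/
def IsCoreCurve (β : C(Circle, BaseAnnulus)) : Prop :=
  Function.Injective β ∧ (∀ z, β z ∉ BaseAnnulus.bdry) ∧
    (β.Homotopic (coreCircle (ContinuousMap.id Circle)) ∨
      β.Homotopic (coreCircle ⟨fun z => z⁻¹, continuous_inv⟩))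

/-- The closed curve `β` as a loop based at its point `β z₀`. -/
noncomputable def basedLoop (β : C(Circle, BaseAnnulus)) (z₀ : Circle) : Path (β z₀) (β z₀) where
  toFun r := β (z₀ * Circle.exp (2 * Real.pi * r))
  continuous_toFun := by fun_prop
  source' := by simp
  target' := by simp

/-- A generating system of sweeps `h(γⱼ, β)` of `(B, b)`, `b` consisting of `n = m + 1` arcs: one
sweep for each arc of `b` except for the last one. -/
structure SweepSystem {m : ℕ} (b : BoundaryArcs (m + 1)) where
  /-- The core curve `β`. -/
  β : C(Circle, BaseAnnulus)
  isCoreCurve : IsCoreCurve β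
  /-- The arcs `γⱼ`. -/
  γ : Fin m → C(unitInterval, BaseAnnulus)
  isArcAround : ∀ j, b.IsArcAround j.castSucc (γ j)
  /-- The parameter on `γⱼ` of the intersection point `xⱼ` of `γⱼ` and `β`. -/
  s : Fin m → unitInterval
  /-- The parameter on `β` of the intersection point `xⱼ` of `γⱼ` and `β`. -/
  z : Fin m → Circle
  inter_point : ∀ j, γ j (s j) = β (z j)
  inter_eq : ∀ j, Set.range (γ j) ∩ Set.range β = {β (z j)}
  /-- The sweeps. -/
  h : Fin m → C(BaseAnnulus, BaseAnnulus)
  isSweep : ∀ j, b.IsSweep (γ j) (s j)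
    ((basedLoop β (z j)).cast (inter_point j) (inter_point j)) (h j)

/-- `a` is an embedded arc of `B` that joins the two boundary components of `B` and is disjoint
from `b`, and `D : B × S¹ → B × S¹` is a Dehn twist about the vertical essential annulus
`A = a × S¹`: for a regular neighbourhood `N` of `a`, it is the identity off `N × S¹`, and on
`N × S¹ = A × [-1,1]` it rotates the fibre `S¹` by a full turn as one passes from one side of `A`
to the other. (Both signs of the twist arise, from the two orientations of the transverse
coordinate.) -/
structure IsVerticalDehnTwist {n : ℕ} (b : BoundaryArcs n) (a : C(unitInterval, BaseAnnulus))
    (D : C(BaseAnnulus × Circle, BaseAnnulus × Circle)) : Prop where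
  start_mem : (a 0).2 = 0
  end_mem : (a 1).2 = 1
  twist : ∃ ν : C(unitInterval × ℝ, BaseAnnulus), b.IsRegularNhd a ν ∧
    (∀ p ∉ ν '' (Set.univ ×ˢ Set.Icc (-1 : ℝ) 1), ∀ w, D (p, w) = (p, w)) ∧
    ∀ s, ∀ r ∈ Set.Icc (-1 : ℝ) 1, ∀ w,
      D (ν (s, r), w) = (ν (s, r), Circle.exp (Real.pi * (r + 1)) * w)

/-! ## Maps of `T = B × S¹` -/

section Transport

variable {T : Type*} [TopologicalSpace T] (Φ : T ≃ₜ BaseAnnulus × Circle)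

/-- The map of `T` that corresponds to a map of `B × S¹`. -/
noncomputable def transportMap (f : C(BaseAnnulus × Circle, BaseAnnulus × Circle)) : C(T, T) :=
  ⟨fun x => Φ.symm (f (Φ x)), by fun_prop⟩

/-- The sweep `H(γ, β) = h(γ, β) × id` of `T` that a sweep `h(γ, β)` of `B` defines. -/
noncomputable def thickenedSweep (h : C(BaseAnnulus, BaseAnnulus)) : C(T, T) :=
  transportMap Φ (h.prodMap (ContinuousMap.id Circle))

/-- The map `p₁ ∘ f ∘ s : B → B` that a map `f` of `T` defines, where `p₁ : T → B` is the projection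
and `s : B → T`, `s(p) = (p, 1)`, is the section. -/
noncomputable def baseMap (f : C(T, T)) : C(BaseAnnulus, BaseAnnulus) :=
  ⟨fun p => (Φ (f (Φ.symm (p, 1)))).1, by fun_prop⟩

end Transport

/-- `q` induces the identity on the (abelian) fundamental group of `B`, stated for free homotopy
classes of loops. -/
def InducesIdOnLoops (q : C(BaseAnnulus, BaseAnnulus)) : Prop :=
  ∀ δ : C(Circle, BaseAnnulus), (q.comp δ).Homotopic δ

/-- The frontier of `T` in `M`, as a subset of `T`. -/
def frontierIn {M : Type*} [TopologicalSpace M] (T : Set M) : Set T :=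
  {x | (x : M) ∈ frontier T}

/-!
A map `f` of `B × S¹ = S¹ × [0,1] × S¹` is controlled by its two circle-valued components. Since a
circle-valued map on `B × S¹` is, up to a real-valued angle, a character `z ^ p * w ^ q`
(`exists_angle_form`), and since `f` moves each annulus `bⱼ × S¹` within itself by a map isotopic to
the identity, `f` has the form `(z, t, w) ↦ (z ^ p * exp θ, ⋯, z ^ k * w * exp ψ)` with real
functions `θ`, `ψ`, and `p = ±1` because `f` is a homotopy equivalence. Because `f` preserves each
arc `bⱼ`, the function `θ` displaces `bⱼ`, measured in the universal cover of `∂₁B`, by an integral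
number `uⱼ` of turns; changing `θ` by a multiple of `2π` adds a common integer to all `uⱼ`. The
invariants of `f` are thus `p = ±1`, `k ∈ ℤ` and `u ∈ ℤⁿ / ℤ(1, …, 1)`
(`BoundaryArcs.HasInvariants`).

* They determine the path component of `f` (`BoundaryArcs.joined_of_invariants`). By the homotopy
  extension property of `b × S¹`, a consequence of the Tietze theorem, both maps can be deformed to
  fix `b × S¹` pointwise. Equal `u` then means that the functions `θ` of the two maps agree on `b ×
  S¹`, and that the linear homotopy between the angles only rotates the fibres over each `bⱼ`, by a
  multiple of `2π` in all. These rotations are homeomorphisms isotopic to the identity, which is why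
  `ψ` carries no further invariant.
* All values occur (`BoundaryArcs.exists_of_invariants`), by Tietze extension of prescribed angles.
* Under composition, `(p, k, u) (p', k', u') = (p p', k p' + k', u + p u')`
  (`BoundaryArcs.HasInvariants.comp`). So `E(T, Fr(T))` is a group, and `p = 1` defines a subgroup
  of index two, isomorphic to `ℤ × ℤⁿ / ℤ(1, …, 1) ≅ ℤⁿ` (`BoundaryArcs.exists_subgroup`). It is
  `E₀`, as `p` is the degree of the base map (`BoundaryArcs.inducesIdOnLoops_iff`).

A Dehn twist has `p = 1`, `k = ±1` and `u = 0` (`IsVerticalDehnTwist.exists_hasInvariants`). A sweep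
of `γⱼ` has `p = 1`, `k = 0`, and `u` equal to `±1` at `j` and to `0` elsewhere
(`BoundaryArcs.IsSweep.exists_hasInvariants`): it is the identity on `∂₀B`, so that `p = 1` and `θ`
is single-valued on `∂₁B`, locally constant off the two ends of the regular neighbourhood of `γⱼ`,
and it jumps by the winding `±2π` of `β` across each of them. The two ends separate `bⱼ` from the
other arcs. These classes with `j < n`, and the Dehn twist, form a basis of `ℤ × ℤⁿ / ℤ(1, …, 1)`.
-/

open Real Set Topology

/-! ### Lifting circle-valued maps -/

/-- Homotopy lifting along `Circle.exp`. -/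
theorem exists_lift_homotopy {Y : Type*} [TopologicalSpace Y] (H : C(unitInterval × Y, Circle))
    (f : C(Y, ℝ)) (h0 : ∀ y, H (0, y) = Circle.exp (f y)) :
    ∃ φ : C(unitInterval × Y, ℝ), (∀ p, Circle.exp (φ p) = H p) ∧ ∀ y, φ (0, y) = f y :=
  ⟨Circle.isCoveringMap_exp.liftHomotopy H f h0,
    fun p => congrFun (Circle.isCoveringMap_exp.liftHomotopy_lifts H f h0) p,
    Circle.isCoveringMap_exp.liftHomotopy_zero H f h0⟩

/-- A circle-valued map on a space that is contracted to a point by `c` has a real lift. -/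
theorem exists_lift_of_contraction {Y : Type*} [TopologicalSpace Y] (c : C(unitInterval × Y, Y))
    (y₀ : Y) (h0 : ∀ y, c (0, y) = y₀) (h1 : ∀ y, c (1, y) = y) (g : C(Y, Circle)) :
    ∃ θ : C(Y, ℝ), ∀ y, Circle.exp (θ y) = g y := by
  obtain ⟨φ, h, -⟩ := exists_lift_homotopy (g.comp c)
    (ContinuousMap.const Y (Complex.arg (g y₀ : ℂ))) (fun y => by simp [h0, Circle.exp_arg])
  exact ⟨⟨fun y => φ (1, y), by fun_prop⟩, fun y => by simp [h, h1]⟩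

theorem exists_lift_path (g : C(unitInterval, Circle)) :
    ∃ θ : C(unitInterval, ℝ), ∀ y, Circle.exp (θ y) = g y :=
  exists_lift_of_contraction ⟨fun p => p.1 * p.2, by fun_prop⟩ 0 (by simp) (by simp) g

/-- A continuous function with values in `2πℤ` is constant on a connected set. -/
theorem eq_of_exp_eq_one {Y : Type*} [TopologicalSpace Y] {S : Set Y} (hS : IsPreconnected S)
    {f : Y → ℝ} (hf : ContinuousOn f S) (h : ∀ y ∈ S, Circle.exp (f y) = 1) {y y' : Y}
    (hy : y ∈ S) (hy' : y' ∈ S) : f y = f y' :=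
  Circle.isCoveringMap_exp.constOn_of_comp hS hf
    (fun a ha a' ha' => (h a ha).trans (h a' ha').symm) hy hy'

theorem exists_int_of_exp_eq {x y : ℝ} (h : Circle.exp x = Circle.exp y) :
    ∃ c : ℤ, x = y + 2 * π * c := by
  obtain ⟨c, hc⟩ := Circle.exp_eq_exp.1 h
  exact ⟨c, by rw [hc]; ring⟩

/-- The exponential covering `ℝ × [0,1] × ℝ → B × S¹`. -/
noncomputable def thickCover : C(ℝ × unitInterval × ℝ, BaseAnnulus × Circle) :=
  ⟨fun v => ((Circle.exp v.1, v.2.1), Circle.exp v.2.2), by fun_prop⟩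

theorem thickCover_isOpenQuotientMap : IsOpenQuotientMap thickCover := by
  have hE : IsOpenQuotientMap Circle.exp :=
    ⟨Circle.exp_surjective, Circle.exp.continuous, isLocalHomeomorph_circleExp.isOpenMap⟩
  have h := (Homeomorph.prodAssoc Circle unitInterval Circle).symm.isOpenQuotientMap.comp
    (hE.prodMap ((IsOpenQuotientMap.id (X := unitInterval)).prodMap hE))
  exact h

/-- Every circle-valued map on `B × S¹` is a monomial up to a null-homotopic factor. -/
theorem exists_angle_form (g : C(BaseAnnulus × Circle, Circle)) :
    ∃ (p q : ℤ) (θ : C(BaseAnnulus × Circle, ℝ)),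
      ∀ x, g x = x.1.1 ^ p * x.2 ^ q * Circle.exp (θ x) := by
  obtain ⟨Θ, hΘ⟩ := exists_lift_of_contraction
    (Y := ℝ × unitInterval × ℝ)
    ⟨fun p => ((p.1 : ℝ) * p.2.1, p.1 * p.2.2.1, (p.1 : ℝ) * p.2.2.2), by fun_prop⟩
    (0, 0, 0) (by simp) (by simp) (g.comp thickCover)
  -- The deck transformations change the lift by constants in `2πℤ`.
  have key : ∀ a b : ℝ, Circle.exp a = 1 → Circle.exp b = 1 → ∃ c : ℤ, ∀ x s y,
      Θ (x + a, s, y + b) = Θ (x, s, y) + 2 * π * c := by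
    intro a b ha hb
    have h1 : ∀ v : ℝ × unitInterval × ℝ,
        Circle.exp (Θ (v.1 + a, v.2.1, v.2.2 + b) - Θ v) = 1 := by
      intro v
      simp [hΘ, thickCover, Circle.exp_add, ha, hb]
    obtain ⟨c, hc⟩ := Circle.exp_eq_one.1 (h1 (0, 0, 0))
    refine ⟨c, fun x s y => ?_⟩
    have := eq_of_exp_eq_one (S := univ) isPreconnected_univ
      (f := fun v : ℝ × unitInterval × ℝ => Θ (v.1 + a, v.2.1, v.2.2 + b) - Θ v)
      (by fun_prop) (fun v _ => h1 v) (mem_univ (x, s, y)) (mem_univ (0, 0, 0))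
    simp only at this hc
    linarith
  obtain ⟨p, hp⟩ := key (2 * π) 0 (by simp) (by simp)
  obtain ⟨q, hq⟩ := key 0 (2 * π) (by simp) (by simp)
  simp only [add_zero] at hp hq
  have hpn : ∀ (n : ℤ) x s y, Θ (x + n * (2 * π), s, y) = Θ (x, s, y) + 2 * π * p * n := by
    intro n
    induction n using Int.induction_on with
    | zero => simp
    | succ n ih =>
      intro x s y
      have := hp (x + n * (2 * π)) s y
      push_cast at ih ⊢
      rw [show x + ((n : ℝ) + 1) * (2 * π) = x + n * (2 * π) + 2 * π by ring, this, ih]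
      ring
    | pred n ih =>
      intro x s y
      have := hp (x + (-(n : ℝ) - 1) * (2 * π)) s y
      push_cast at ih ⊢
      rw [show x + (-(n : ℝ) - 1) * (2 * π) + 2 * π = x + -(n : ℝ) * (2 * π) by ring, ih] at this
      linarith
  have hqn : ∀ (n : ℤ) x s y, Θ (x, s, y + n * (2 * π)) = Θ (x, s, y) + 2 * π * q * n := by
    intro n
    induction n using Int.induction_on with
    | zero => simp
    | succ n ih =>
      intro x s y
      have := hq x s (y + n * (2 * π))
      push_cast at ih ⊢
      rw [show y + ((n : ℝ) + 1) * (2 * π) = y + n * (2 * π) + 2 * π by ring, this, ih]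
      ring
    | pred n ih =>
      intro x s y
      have := hq x s (y + (-(n : ℝ) - 1) * (2 * π))
      push_cast at ih ⊢
      rw [show y + (-(n : ℝ) - 1) * (2 * π) + 2 * π = y + -(n : ℝ) * (2 * π) by ring, ih] at this
      linarith
  let Ψ : C(ℝ × unitInterval × ℝ, ℝ) := ⟨fun v => Θ v - p * v.1 - q * v.2.2, by fun_prop⟩
  have hfac : Function.FactorsThrough Ψ thickCover := by
    rintro ⟨x, s, y⟩ ⟨x', s', y'⟩ h
    simp only [thickCover, ContinuousMap.coe_mk, Prod.mk.injEq] at h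
    obtain ⟨⟨h1, rfl⟩, h2⟩ := h
    obtain ⟨m, rfl⟩ := Circle.exp_eq_exp.1 h1
    obtain ⟨n, rfl⟩ := Circle.exp_eq_exp.1 h2
    simp only [Ψ, ContinuousMap.coe_mk, hpn, hqn]
    ring
  refine ⟨p, q, thickCover_isOpenQuotientMap.isQuotientMap.lift Ψ hfac, fun x => ?_⟩
  obtain ⟨⟨x, s, y⟩, rfl⟩ := thickCover_isOpenQuotientMap.surjective x
  have : thickCover_isOpenQuotientMap.isQuotientMap.lift Ψ hfac (thickCover (x, s, y))
      = Ψ (x, s, y) :=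
    DFunLike.congr_fun (thickCover_isOpenQuotientMap.isQuotientMap.lift_comp Ψ hfac) (x, s, y)
  rw [this]
  have h2 := hΘ (x, s, y)
  simp only [ContinuousMap.comp_apply] at h2
  rw [← h2]
  simp only [thickCover, Ψ, ContinuousMap.coe_mk]
  rw [← Circle.exp_intCast_mul, ← Circle.exp_intCast_mul, ← Circle.exp_add, ← Circle.exp_add]
  congr 1
  ring

theorem angle_form_unique {p q p' q' : ℤ} {θ θ' : C(BaseAnnulus × Circle, ℝ)}
    (h : ∀ x : BaseAnnulus × Circle, x.1.1 ^ p * x.2 ^ q * Circle.exp (θ x) =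
      x.1.1 ^ p' * x.2 ^ q' * Circle.exp (θ' x)) :
    p = p' ∧ q = q' ∧ ∃ c : ℤ, ∀ x, θ x = θ' x + 2 * π * c := by
  have hone : ∀ v : ℝ × unitInterval × ℝ, Circle.exp ((p * v.1 + q * v.2.2 + θ (thickCover v)) -
      (p' * v.1 + q' * v.2.2 + θ' (thickCover v))) = 1 := by
    intro v
    rw [Circle.exp_sub, div_eq_one]
    simpa [Circle.exp_add, thickCover] using h (thickCover v)
  have hc := fun v w => eq_of_exp_eq_one (S := univ) isPreconnected_univ
    (f := fun v : ℝ × unitInterval × ℝ => (p * v.1 + q * v.2.2 + θ (thickCover v)) -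
      (p' * v.1 + q' * v.2.2 + θ' (thickCover v))) (by fun_prop) (fun v _ => hone v)
      (mem_univ v) (mem_univ w)
  have e1 : thickCover (2 * π, 0, 0) = thickCover (0, 0, 0) := by simp [thickCover]
  have e2 : thickCover (0, 0, 2 * π) = thickCover (0, 0, 0) := by simp [thickCover]
  have h1 := hc (2 * π, 0, 0) (0, 0, 0)
  have h2 := hc (0, 0, 2 * π) (0, 0, 0)
  simp only [e1, e2, mul_zero, add_zero, zero_add] at h1 h2
  have hp : p = p' := by
    have : (p - p' : ℝ) * (2 * π) = 0 := by linarith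
    have := (mul_eq_zero.1 this).resolve_right two_pi_pos.ne'
    exact_mod_cast sub_eq_zero.1 this
  have hq : q = q' := by
    have : (q - q' : ℝ) * (2 * π) = 0 := by linarith
    have := (mul_eq_zero.1 this).resolve_right two_pi_pos.ne'
    exact_mod_cast sub_eq_zero.1 this
  subst hp hq
  refine ⟨rfl, rfl, ?_⟩
  obtain ⟨c, hcc⟩ := Circle.exp_eq_one.1 (hone (0, 0, 0))
  refine ⟨c, fun x => ?_⟩
  obtain ⟨v, rfl⟩ := thickCover_isOpenQuotientMap.surjective x
  have := hc v (0, 0, 0)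
  simp only at this hcc
  linarith

/-! ### Angle functions and the pieces of the frontier -/

/-- The angle of `z` in the window `(c - π, c + π]`. -/
noncomputable def angleAt (c : ℝ) (z : Circle) : ℝ :=
  c + Complex.arg ((z * Circle.exp (-c) : Circle) : ℂ)

@[simp] theorem exp_angleAt (c : ℝ) (z : Circle) : Circle.exp (angleAt c z) = z := by
  rw [angleAt, Circle.exp_add, Circle.exp_arg, Circle.exp_neg]
  exact mul_inv_cancel_comm_assoc _ _

theorem angleAt_exp {c x : ℝ} (h1 : c - π < x) (h2 : x ≤ c + π) :
    angleAt c (Circle.exp x) = x := by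
  rw [angleAt, ← Circle.exp_add, Circle.arg_exp] <;> linarith

theorem angleAt_mem (c : ℝ) (z : Circle) : angleAt c z ∈ Ioc (c - π) (c + π) := by
  have h1 := Complex.neg_pi_lt_arg ((z * Circle.exp (-c) : Circle) : ℂ)
  have h2 := Complex.arg_le_pi ((z * Circle.exp (-c) : Circle) : ℂ)
  unfold angleAt
  constructor <;> linarith

theorem continuousAt_angleAt {c : ℝ} {z : Circle} (h : angleAt c z ≠ c + π) :
    ContinuousAt (angleAt c) z := by
  have hs : ((z * Circle.exp (-c) : Circle) : ℂ) ∈ Complex.slitPlane := by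
    rw [Complex.mem_slitPlane_iff_arg]
    exact ⟨fun h' => h (by rw [angleAt, h']), Circle.coe_ne_zero _⟩
  refine continuousAt_const.add (ContinuousAt.comp (g := Complex.arg)
    (f := fun z : Circle => ((z * Circle.exp (-c) : Circle) : ℂ)) ?_ ?_)
  · exact Complex.continuousAt_arg hs
  · fun_prop

theorem isPreconnected_univ_circle : IsPreconnected (univ : Set Circle) := by
  rw [← Circle.exp_surjective.range_eq]
  exact isPreconnected_range Circle.exp.continuous

namespace BoundaryArcs

variable {n : ℕ} (b : BoundaryArcs n)

theorem exists_lo_hi (j : Fin n) : ∃ lo hi : ℝ, lo < hi ∧ hi < lo + 2 * π ∧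
    range (b.arc j) = Circle.exp '' Icc lo hi := by
  obtain ⟨l, hl⟩ := exists_lift_path (b.arc j)
  have hinj : Function.Injective l := fun s t h => b.arc_injective j (by rw [← hl, ← hl, h])
  have h2π : ∀ s t, l s ≠ l t + 2 * π := by
    intro s t h
    have : s = t := b.arc_injective j (by rw [← hl, ← hl, h, Circle.exp_add_two_pi])
    subst this
    linarith [two_pi_pos]
  have hr : range (b.arc j) = Circle.exp '' range l := by
    rw [← range_comp]
    congr 1
    exact funext fun t => (hl t).symm
  have main : ∀ s t : unitInterval, l s < l t → (∀ r, l r ∈ Icc (l s) (l t)) →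
      ∃ lo hi : ℝ, lo < hi ∧ hi < lo + 2 * π ∧ range (b.arc j) = Circle.exp '' Icc lo hi := by
    intro s t hst hmem
    have hrange : range l = Icc (l s) (l t) :=
      Subset.antisymm (range_subset_iff.2 hmem) (intermediate_value_univ s t l.continuous)
    refine ⟨l s, l t, hst, ?_, by rw [hr, hrange]⟩
    by_contra! hge
    obtain ⟨r, hr⟩ : l s + 2 * π ∈ range l := by
      rw [hrange]; exact ⟨by linarith [two_pi_pos], hge⟩
    exact h2π r s hr
  rcases l.continuous.strictMono_of_inj hinj with hm | hm
  · exact main 0 1 (hm zero_lt_one) fun r => ⟨hm.monotone r.2.1, hm.monotone r.2.2⟩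
  · exact main 1 0 (hm zero_lt_one) fun r => ⟨hm.antitone r.2.2, hm.antitone r.2.1⟩

/-- The angle at which the arc `bⱼ` starts. -/
noncomputable def lo (j : Fin n) : ℝ := (b.exists_lo_hi j).choose

/-- The angle at which the arc `bⱼ` ends. -/
noncomputable def hi (j : Fin n) : ℝ := (b.exists_lo_hi j).choose_spec.choose

theorem lo_lt_hi (j : Fin n) : b.lo j < b.hi j := (b.exists_lo_hi j).choose_spec.choose_spec.1

theorem hi_lt (j : Fin n) : b.hi j < b.lo j + 2 * π :=
  (b.exists_lo_hi j).choose_spec.choose_spec.2.1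

theorem range_arc (j : Fin n) : range (b.arc j) = Circle.exp '' Icc (b.lo j) (b.hi j) :=
  (b.exists_lo_hi j).choose_spec.choose_spec.2.2

/-- The angle on the arc `bⱼ`, with values in `[lo j, hi j]`; off `bⱼ` the value is irrelevant. -/
noncomputable def angle (j : Fin n) (z : Circle) : ℝ := angleAt ((b.lo j + b.hi j) / 2) z

@[simp] theorem exp_angle (j : Fin n) (z : Circle) : Circle.exp (b.angle j z) = z :=
  exp_angleAt _ _

theorem angle_exp (j : Fin n) {x : ℝ} (hx : x ∈ Icc (b.lo j) (b.hi j)) :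
    b.angle j (Circle.exp x) = x := by
  have := b.hi_lt j
  exact angleAt_exp (by linarith [hx.1]) (by linarith [hx.2])

theorem continuousOn_angle (j : Fin n) : ContinuousOn (b.angle j) (range (b.arc j)) := by
  intro z hz
  rw [range_arc] at hz
  obtain ⟨x, hx, rfl⟩ := hz
  refine (continuousAt_angleAt ?_).continuousWithinAt
  have h := b.angle_exp j hx
  rw [angle] at h
  rw [h]
  have := b.hi_lt j
  exact ne_of_lt (by linarith [hx.2])

theorem isClosed_range_arc (j : Fin n) : IsClosed (range (b.arc j)) :=
  (isCompact_range (b.arc j).continuous).isClosed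

theorem isClosed_union : IsClosed b.union :=
  isClosed_iUnion_of_finite fun j => b.isClosed_range_arc j

theorem range_arc_subset (j : Fin n) : range (b.arc j) ⊆ b.union :=
  subset_iUnion (fun j => range (b.arc j)) j

/-- Functions on the single arcs have a common continuous extension to the circle. -/
theorem exists_common_extension (F : Fin n → Circle → ℝ)
    (hF : ∀ j, ContinuousOn (F j) (range (b.arc j))) :
    ∃ G : C(Circle, ℝ), ∀ j, ∀ z ∈ range (b.arc j), G z = F j z := by
  classical
  let g : Circle → ℝ := fun z => if h : ∃ j, z ∈ range (b.arc j) then F h.choose z else 0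
  have hg : ∀ j, ∀ z ∈ range (b.arc j), g z = F j z := by
    intro j z hz
    have h : ∃ j, z ∈ range (b.arc j) := ⟨j, hz⟩
    have : h.choose = j := by
      by_contra hne
      exact (Set.disjoint_left.1 (b.arc_disjoint _ _ hne)) h.choose_spec hz
    simp only [g, dif_pos h, this]
  have hcont : ContinuousOn g b.union :=
    (locallyFinite_of_finite _).continuousOn_iUnion (fun j => b.isClosed_range_arc j)
      fun j => (hF j).congr (hg j)
  obtain ⟨G, hG⟩ := ContinuousMap.exists_restrict_eq b.isClosed_union
    (⟨b.union.domRestrict g, hcont.domRestrict⟩ : C(b.union, ℝ))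
  exact ⟨G, fun j z hz => (DFunLike.congr_fun hG ⟨z, b.range_arc_subset j hz⟩).trans (hg j z hz)⟩

/-- The union `b × S¹` of annuli. -/
def thick : Set (BaseAnnulus × Circle) := {x | x.1 ∈ b.carrier}

/-- The annulus `bⱼ × S¹`. -/
def piece (j : Fin n) : Set (BaseAnnulus × Circle) := {x | x.1.2 = 1 ∧ x.1.1 ∈ range (b.arc j)}

theorem isClosed_piece (j : Fin n) : IsClosed (b.piece j) :=
  (isClosed_eq (by fun_prop) (by fun_prop)).inter
    ((b.isClosed_range_arc j).preimage (by fun_prop))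

theorem thick_eq : b.thick = ⋃ j, b.piece j := by
  ext x
  simp [thick, carrier, piece, union]

theorem piece_subset (j : Fin n) : b.piece j ⊆ b.thick := by
  rw [thick_eq]; exact subset_iUnion b.piece j

theorem isClosed_thick : IsClosed b.thick := by
  rw [thick_eq]; exact isClosed_iUnion_of_finite b.isClosed_piece

theorem isPreconnected_piece (j : Fin n) : IsPreconnected (b.piece j) := by
  have h : b.piece j =
      (fun v : unitInterval × Circle => (((b.arc j v.1, 1), v.2) : BaseAnnulus × Circle)) ''
        univ ×ˢ univ := by
    ext ⟨⟨z, s⟩, w⟩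
    simp only [piece, mem_ofPred_eq, mem_range, univ_prod_univ, image_univ, Prod.exists,
      Prod.mk.injEq]
    constructor
    · rintro ⟨rfl, y, rfl⟩
      exact ⟨y, w, ⟨rfl, rfl⟩, rfl⟩
    · rintro ⟨y, w', ⟨rfl, rfl⟩, rfl⟩
      exact ⟨rfl, y, rfl⟩
  rw [h]
  exact (isPreconnected_univ.prod isPreconnected_univ_circle).image _ (by fun_prop)

theorem piece_disjoint {i j : Fin n} (h : i ≠ j) : Disjoint (b.piece i) (b.piece j) :=
  Set.disjoint_left.2 fun _ hi hj => Set.disjoint_left.1 (b.arc_disjoint i j h) hi.2 hj.2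

/-- An isotopy of `b × S¹` preserves each annulus. -/
theorem isotopy_mem_piece {F : C(unitInterval × b.thick, b.thick)} (h0 : ∀ a, F (0, a) = a)
    {j : Fin n} {a : b.thick} (ha : (a : BaseAnnulus × Circle) ∈ b.piece j) (t : unitInterval) :
    (F (t, a) : BaseAnnulus × Circle) ∈ b.piece j := by
  let c : unitInterval → BaseAnnulus × Circle := fun t => F (t, a)
  have hc : Continuous c := by fun_prop
  have hopen : (c ⁻¹' b.piece j)ᶜ = ⋃ i ∈ {i | i ≠ j}, c ⁻¹' b.piece i := by
    ext t
    simp only [mem_compl_iff, mem_preimage, mem_ofPred_eq, mem_iUnion, exists_prop]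
    constructor
    · intro h
      have hm : c t ∈ b.thick := (F (t, a)).2
      rw [thick_eq, mem_iUnion] at hm
      obtain ⟨i, hi⟩ := hm
      exact ⟨i, fun e => h (e ▸ hi), hi⟩
    · rintro ⟨i, hne, hi⟩ h
      exact Set.disjoint_left.1 (b.piece_disjoint hne) hi h
  have hclopen : IsClopen (c ⁻¹' b.piece j) := by
    refine ⟨(b.isClosed_piece j).preimage hc, ?_⟩
    rw [← isClosed_compl_iff, hopen]
    exact (Set.toFinite _).isClosed_biUnion fun i _ => (b.isClosed_piece i).preimage hc
  have := hclopen.eq_univ ⟨0, by simpa [c, h0] using ha⟩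
  exact (this ▸ mem_univ t : t ∈ c ⁻¹' b.piece j)

theorem mem_piece_of_isotopic {f : C(BaseAnnulus × Circle, BaseAnnulus × Circle)}
    (hf : RestrictsToIsotopicId b.thick f) {j : Fin n} {x : BaseAnnulus × Circle}
    (hx : x ∈ b.piece j) : f x ∈ b.piece j := by
  obtain ⟨F, -, h0, h1⟩ := hf
  have := b.isotopy_mem_piece h0 (a := ⟨x, b.piece_subset j hx⟩) hx 1
  rwa [h1] at this

end BoundaryArcs

/-! ### Numerical invariants of maps of the pair `(B × S¹, b × S¹)` -/

/-- Homotopic circle-valued maps differ by a null-homotopic factor. -/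
theorem exists_angle_of_homotopic {Y : Type*} [TopologicalSpace Y] {f g : C(Y, Circle)}
    (h : f.Homotopic g) : ∃ φ : C(Y, ℝ), ∀ y, g y = f y * Circle.exp (φ y) := by
  obtain ⟨H⟩ := h
  obtain ⟨φ, h1, -⟩ := exists_lift_homotopy
    (⟨fun p => H p / f p.2, by fun_prop⟩ : C(unitInterval × Y, Circle)) 0 (by simp)
  refine ⟨⟨fun y => φ (1, y), by fun_prop⟩, fun y => ?_⟩
  have := h1 (1, y)
  simp only [ContinuousMap.coe_mk, ContinuousMap.Homotopy.apply_one] at this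
  simp [this]

/-- Maps `Y → B` whose circle coordinates differ by a null-homotopic factor are homotopic. -/
theorem homotopic_of_angle {Y : Type*} [TopologicalSpace Y] {f g : C(Y, BaseAnnulus)}
    (θ : C(Y, ℝ)) (h : ∀ y, (g y).1 = (f y).1 * Circle.exp (θ y)) : f.Homotopic g := by
  have h1 : (⟨fun y => (f y).1, by fun_prop⟩ : C(Y, Circle)).Homotopic
      ⟨fun y => (g y).1, by fun_prop⟩ :=
    ⟨{ toFun := fun p => (f p.2).1 * Circle.exp (p.1 * θ p.2)
       continuous_toFun := by fun_prop
       map_zero_left := by simp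
       map_one_left := by simp [h] }⟩
  have h2 : (⟨fun y => (f y).2, by fun_prop⟩ : C(Y, unitInterval)).Homotopic
      ⟨fun y => (g y).2, by fun_prop⟩ := by
    have hI := fun u : C(Y, unitInterval) =>
      (show u.Homotopic (ContinuousMap.const Y 0) from
        ⟨{ toFun := fun p => unitInterval.symm p.1 * u p.2
           continuous_toFun := by fun_prop
           map_zero_left := by simp
           map_one_left := by simp }⟩)
    exact (hI _).trans (hI _).symm
  exact h1.prodMk h2

theorem homotopic_of_angles {Y : Type*} [TopologicalSpace Y] {f g : C(Y, BaseAnnulus × Circle)}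
    (θ ψ : C(Y, ℝ)) (h : ∀ y, (g y).1.1 = (f y).1.1 * Circle.exp (θ y))
    (h' : ∀ y, (g y).2 = (f y).2 * Circle.exp (ψ y)) : f.Homotopic g := by
  have h1 : (ContinuousMap.fst.comp f).Homotopic (ContinuousMap.fst.comp g) :=
    homotopic_of_angle θ h
  have h2 : (ContinuousMap.snd.comp f).Homotopic (ContinuousMap.snd.comp g) :=
    ⟨{ toFun := fun p => (f p.2).2 * Circle.exp (p.1 * ψ p.2)
       continuous_toFun := by fun_prop
       map_zero_left := by simp
       map_one_left := by simp [h'] }⟩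
  exact h1.prodMk h2

theorem circle_form_unique {q q' : ℤ} {θ θ' : C(Circle, ℝ)}
    (h : ∀ w : Circle, w ^ q * Circle.exp (θ w) = w ^ q' * Circle.exp (θ' w)) : q = q' :=
  (angle_form_unique (p := 0) (p' := 0) (θ := θ.comp ContinuousMap.snd)
    (θ' := θ'.comp ContinuousMap.snd) (fun x => by simpa using h x.2)).2.1

theorem IsSelfHomotopyEquiv.of_homotopic {X : Type*} [TopologicalSpace X] {f g : C(X, X)}
    (hf : IsSelfHomotopyEquiv f) (h : f.Homotopic g) : IsSelfHomotopyEquiv g := by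
  obtain ⟨k, h1, h2⟩ := hf
  exact ⟨k, ((ContinuousMap.Homotopic.refl k).comp h.symm).trans h1,
    (h.symm.comp (ContinuousMap.Homotopic.refl k)).trans h2⟩

/-- The linear model `(z, s, w) ↦ (zᵖ, s, zᵏ w)`. -/
noncomputable def linearModel (p k : ℤ) : C(BaseAnnulus × Circle, BaseAnnulus × Circle) :=
  ⟨fun x => ((x.1.1 ^ p, x.1.2), x.1.1 ^ k * x.2), by fun_prop⟩

theorem linearModel_isSelfHomotopyEquiv {p : ℤ} (hp : p * p = 1) (k : ℤ) :
    IsSelfHomotopyEquiv (linearModel p k) := by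
  have h : ∀ z : Circle, (z ^ p) ^ p = z := fun z => by rw [← zpow_mul, hp, zpow_one]
  have h' : ∀ z : Circle, z ^ (p * (p * k)) = z ^ k := fun z => by
    rw [← mul_assoc, hp, one_mul]
  refine ⟨linearModel p (-(p * k)), ?_, ?_⟩
  · convert ContinuousMap.Homotopic.refl _
    ext x <;> simp [linearModel, h, ← zpow_mul, h']
  · convert ContinuousMap.Homotopic.refl _
    ext x <;> simp [linearModel, h, ← zpow_mul]

namespace BoundaryArcs

variable {n : ℕ} (b : BoundaryArcs n)

/-- The invariants of a map `f` of `B × S¹` that preserves each annulus `bⱼ × S¹`. In homology `f`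
acts by `(1, 0) ↦ (p, k)` and `(0, 1) ↦ (0, 1)`, so that its two circle coordinates are
`zᵖ exp(iθ)` and `zᵏ w exp(iψ)` with real functions `θ` and `ψ`. The integer `u j` counts the turns
around the circle `∂₁B` by which `f` displaces `bⱼ × S¹`. The choice of `θ` matters only up to a
constant in `2πℤ`, so that the tuple `u` is defined up to a common integer. -/
def HasInvariants (f : C(BaseAnnulus × Circle, BaseAnnulus × Circle)) (p k : ℤ)
    (u : Fin n → ℤ) : Prop :=
  ∃ θ ψ : C(BaseAnnulus × Circle, ℝ),
    (∀ x, (f x).1.1 = x.1.1 ^ p * Circle.exp (θ x)) ∧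
    (∀ x, (f x).2 = x.1.1 ^ k * x.2 * Circle.exp (ψ x)) ∧
    ∀ j, ∀ x ∈ b.piece j, f x ∈ b.piece j ∧
      θ x + p * b.angle j x.1.1 - b.angle j (f x).1.1 = 2 * π * u j

variable {b}

theorem HasInvariants.isSelfHomotopyEquiv
    {f : C(BaseAnnulus × Circle, BaseAnnulus × Circle)} {p k : ℤ} {u : Fin n → ℤ}
    (h : b.HasInvariants f p k u) (hp : p * p = 1) : IsSelfHomotopyEquiv f := by
  obtain ⟨θ, ψ, h1, h2, -⟩ := h
  exact (linearModel_isSelfHomotopyEquiv hp k).of_homotopic (homotopic_of_angles θ ψ h1 h2)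

variable (b) in
theorem arc_mem_piece (j : Fin n) (t : unitInterval) (w : Circle) :
    (((b.arc j t, 1), w) : BaseAnnulus × Circle) ∈ b.piece j := ⟨rfl, t, rfl⟩

theorem HasInvariants.unique {f : C(BaseAnnulus × Circle, BaseAnnulus × Circle)}
    {p k p' k' : ℤ} {u u' : Fin n → ℤ} (h : b.HasInvariants f p k u)
    (h' : b.HasInvariants f p' k' u') : p = p' ∧ k = k' ∧ ∃ c : ℤ, ∀ j, u j = u' j + c := by
  obtain ⟨θ, ψ, h1, h2, h3⟩ := h
  obtain ⟨θ', ψ', h1', h2', h3'⟩ := h'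
  obtain ⟨rfl, -, c, hc⟩ := angle_form_unique (p := p) (p' := p') (q := 0) (q' := 0) (θ := θ)
    (θ' := θ') (fun x => by simpa using (h1 x).symm.trans (h1' x))
  obtain ⟨rfl, -, -⟩ := angle_form_unique (p := k) (p' := k') (q := 1) (q' := 1) (θ := ψ)
    (θ' := ψ') (fun x => by simpa using (h2 x).symm.trans (h2' x))
  refine ⟨rfl, rfl, c, fun j => ?_⟩
  have e := (h3 j _ (b.arc_mem_piece j 0 1)).2
  have e' := (h3' j _ (b.arc_mem_piece j 0 1)).2
  rw [hc] at e
  have : (2 * π) * (u j : ℝ) = (2 * π) * (u' j + c : ℝ) := by linarith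
  exact_mod_cast mul_left_cancel₀ two_pi_pos.ne' this

theorem HasInvariants.add_const {f : C(BaseAnnulus × Circle, BaseAnnulus × Circle)}
    {p k : ℤ} {u : Fin n → ℤ} (h : b.HasInvariants f p k u) (c : ℤ) :
    b.HasInvariants f p k (fun j => u j + c) := by
  obtain ⟨θ, ψ, h1, h2, h3⟩ := h
  refine ⟨⟨fun x => θ x + 2 * π * c, by fun_prop⟩, ψ, fun x => ?_, h2, fun j x hx =>
    ⟨(h3 j x hx).1, ?_⟩⟩
  · simp [h1, Circle.exp_add, Circle.exp_two_pi_mul_int]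
  · have := (h3 j x hx).2
    simp only [ContinuousMap.coe_mk]
    push_cast
    linarith

variable (b) in
theorem hasInvariants_id :
    b.HasInvariants (ContinuousMap.id (BaseAnnulus × Circle)) 1 0 (fun _ => 0) :=
  ⟨0, 0, by simp, by simp, fun j x hx => ⟨hx, by simp⟩⟩

theorem HasInvariants.comp {f g : C(BaseAnnulus × Circle, BaseAnnulus × Circle)}
    {p k p' k' : ℤ} {u u' : Fin n → ℤ} (hf : b.HasInvariants f p k u)
    (hg : b.HasInvariants g p' k' u') :
    b.HasInvariants (f.comp g) (p * p') (k * p' + k') (fun j => u j + p * u' j) := by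
  obtain ⟨θ, ψ, h1, h2, h3⟩ := hf
  obtain ⟨θ', ψ', h1', h2', h3'⟩ := hg
  refine ⟨⟨fun x => p * θ' x + θ (g x), by fun_prop⟩, ⟨fun x => k * θ' x + ψ' x + ψ (g x),
    by fun_prop⟩, fun x => ?_, fun x => ?_, fun j x hx => ?_⟩
  · simp only [ContinuousMap.comp_apply, h1, h1', ContinuousMap.coe_mk, Circle.exp_add,
      Circle.exp_intCast_mul, mul_zpow, ← zpow_mul]
    rw [mul_comm p' p, mul_assoc]
  · simp only [ContinuousMap.comp_apply, h2, h1', h2', ContinuousMap.coe_mk, Circle.exp_add,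
      Circle.exp_intCast_mul, mul_zpow, ← zpow_mul, zpow_add]
    rw [mul_comm p' k]
    simp only [mul_assoc, mul_left_comm]
  · obtain ⟨m', e'⟩ := h3' j x hx
    obtain ⟨m, e⟩ := h3 j _ m'
    refine ⟨m, ?_⟩
    simp only [ContinuousMap.comp_apply, ContinuousMap.coe_mk]
    push_cast
    linear_combination e + (p : ℝ) * e'

/-- Every map in the space that defines `E(B × S¹, b × S¹)` has invariants, and its degree `p` on
the base is `±1`. -/
theorem exists_hasInvariants [NeZero n] {f : C(BaseAnnulus × Circle, BaseAnnulus × Circle)}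
    (hf : IsSelfHomotopyEquiv f) (hA : RestrictsToIsotopicId b.thick f) :
    ∃ (p k : ℤ) (u : Fin n → ℤ), p * p = 1 ∧ b.HasInvariants f p k u := by
  obtain ⟨p, q, θ, h1⟩ := exists_angle_form ⟨fun x => (f x).1.1, by fun_prop⟩
  obtain ⟨k, r, ψ, h2⟩ := exists_angle_form ⟨fun x => (f x).2, by fun_prop⟩
  simp only [ContinuousMap.coe_mk] at h1 h2
  have hmem := fun (j : Fin n) x (hx : x ∈ b.piece j) => b.mem_piece_of_isotopic hA hx
  -- A fibre of `bⱼ × S¹`.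
  let j₀ : Fin n := 0
  let z₀ := b.arc j₀ 0
  let ι : C(Circle, BaseAnnulus × Circle) := ⟨fun w => ((z₀, 1), w), by fun_prop⟩
  have hι : ∀ w, ι w ∈ b.piece j₀ := fun w => b.arc_mem_piece j₀ 0 w
  -- Its image lies in `bⱼ × S¹`, hence has degree zero over the base.
  have hq : q = 0 := by
    have hc : Continuous fun w => b.angle j₀ (f (ι w)).1.1 :=
      (b.continuousOn_angle j₀).comp_continuous (by fun_prop) fun w => (hmem j₀ _ (hι w)).2
    refine circle_form_unique (θ := ⟨fun w => p * b.angle j₀ z₀ + θ (ι w), by fun_prop⟩)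
      (θ' := ⟨fun w => b.angle j₀ (f (ι w)).1.1, hc⟩) fun w => ?_
    have := h1 (ι w)
    simp only [ContinuousMap.coe_mk, exp_angle, this, zpow_zero, one_mul, Circle.exp_add,
      Circle.exp_intCast_mul]
    simp only [ι, ContinuousMap.coe_mk]
    ac_rfl
  -- The isotopy shows that its image has degree one over the fibre.
  have hr : r = 1 := by
    obtain ⟨F, -, hF0, hF1⟩ := hA
    let ι' : C(Circle, b.thick) := ⟨fun w => ⟨ι w, b.piece_subset _ (hι w)⟩, by fun_prop⟩
    have hh : (ContinuousMap.id Circle).Homotopic ⟨fun w => (f (ι w)).2, by fun_prop⟩ :=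
      ⟨{ toFun := fun v => (F (v.1, ι' v.2) : BaseAnnulus × Circle).2
         continuous_toFun := by fun_prop
         map_zero_left := by simp [hF0, ι', ι]
         map_one_left := by simp [hF1, ι'] }⟩
    obtain ⟨φ, hφ⟩ := exists_angle_of_homotopic hh
    refine circle_form_unique (θ := ⟨fun w => k * b.angle j₀ z₀ + ψ (ι w), by fun_prop⟩)
      (θ' := φ) fun w => ?_
    have e1 := hφ w
    have e2 := h2 (ι w)
    simp only [ContinuousMap.coe_mk, ContinuousMap.id_apply] at e1
    rw [zpow_one, ← e1, e2]
    simp only [ContinuousMap.coe_mk, exp_angle, Circle.exp_add, Circle.exp_intCast_mul]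
    simp only [ι, ContinuousMap.coe_mk]
    ac_rfl
  subst hq hr
  -- A homotopy inverse forces `p` to be invertible.
  obtain ⟨p', hp'⟩ : ∃ p', p * p' = 1 := by
    obtain ⟨g, hgf, -⟩ := hf
    obtain ⟨p', q', θ', h1'⟩ := exists_angle_form ⟨fun x => (g x).1.1, by fun_prop⟩
    simp only [ContinuousMap.coe_mk] at h1'
    have hh : (⟨fun x => (g (f x)).1.1, by fun_prop⟩ : C(BaseAnnulus × Circle, Circle)).Homotopic
        ⟨fun x => x.1.1, by fun_prop⟩ :=
      (ContinuousMap.Homotopic.refl (⟨fun x => x.1.1, by fun_prop⟩ :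
        C(BaseAnnulus × Circle, Circle))).comp hgf
    obtain ⟨φ, hφ⟩ := exists_angle_of_homotopic hh
    simp only [ContinuousMap.coe_mk] at hφ
    have := angle_form_unique (p := 1) (q := 0) (p' := p * p' + k * q') (q' := q') (θ := 0)
      (θ' := ⟨fun x => p' * θ x + q' * ψ x + θ' (f x) + φ x, by fun_prop⟩) (fun x => by
        simp only [zpow_one, zpow_zero, mul_one, ContinuousMap.zero_apply, Circle.exp_zero]
        refine (hφ x).trans ?_
        rw [h1', h1, h2]
        simp only [zpow_zero, zpow_one, mul_one, ContinuousMap.coe_mk, Circle.exp_add,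
          Circle.exp_intCast_mul, mul_zpow, ← zpow_mul, zpow_add]
        generalize Circle.exp (θ x) ^ p' = a₁
        generalize Circle.exp (ψ x) ^ q' = a₂
        generalize Circle.exp (θ' (f x)) = a₃
        generalize Circle.exp (φ x) = a₄
        ac_rfl)
    obtain ⟨e1, e2, -⟩ := this
    refine ⟨p', ?_⟩
    rw [← e2] at e1
    linarith
  have hint : ∀ j, ∃ u : ℤ, ∀ x ∈ b.piece j,
      θ x + p * b.angle j x.1.1 - b.angle j (f x).1.1 = 2 * π * u := by
    intro j
    have hexp : ∀ x ∈ b.piece j,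
        Circle.exp (θ x + p * b.angle j x.1.1 - b.angle j (f x).1.1) = 1 := by
      intro x hx
      rw [Circle.exp_sub, Circle.exp_add, Circle.exp_intCast_mul, exp_angle, exp_angle, h1,
        zpow_zero, mul_one, mul_comm, div_self']
    obtain ⟨u, hu⟩ := Circle.exp_eq_one.1 (hexp _ (b.arc_mem_piece j 0 1))
    refine ⟨u, fun x hx => ?_⟩
    have hc : ContinuousOn (fun x : BaseAnnulus × Circle =>
        θ x + p * b.angle j x.1.1 - b.angle j (f x).1.1) (b.piece j) := by
      refine ContinuousOn.sub (ContinuousOn.add (by fun_prop) (continuousOn_const.mul ?_)) ?_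
      · exact (b.continuousOn_angle j).comp (by fun_prop) fun x hx => hx.2
      · exact (b.continuousOn_angle j).comp (by fun_prop) fun x hx => (hmem j x hx).2
    rw [eq_of_exp_eq_one (b.isPreconnected_piece j) hc hexp hx (b.arc_mem_piece j 0 1)]
    simp only at hu
    rw [hu]
    ring
  choose u hu using hint
  refine ⟨p, k, u, ?_, θ, ψ, fun x => by simp [h1], fun x => by simp [h2], fun j x hx =>
    ⟨hmem j x hx, hu j x hx⟩⟩
  rcases Int.isUnit_iff.1 (IsUnit.of_mul_eq_one _ hp') with h | h <;> simp [h]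

/-- The invariants do not change along a homotopy that preserves each annulus `bⱼ × S¹`. -/
theorem HasInvariants.of_homotopy {H : C(unitInterval × (BaseAnnulus × Circle),
    BaseAnnulus × Circle)} (hH : ∀ t j, ∀ x ∈ b.piece j, H (t, x) ∈ b.piece j)
    {f g : C(BaseAnnulus × Circle, BaseAnnulus × Circle)} (h0 : ∀ x, H (0, x) = f x)
    (h1 : ∀ x, H (1, x) = g x) {p k : ℤ} {u : Fin n → ℤ} (hf : b.HasInvariants f p k u) :
    b.HasInvariants g p k u := by
  obtain ⟨θ, ψ, e1, e2, e3⟩ := hf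
  obtain ⟨φ, hφ, hφ0⟩ := exists_lift_homotopy
    (⟨fun v => (H v).1.1 / (f v.2).1.1, by fun_prop⟩ :
      C(unitInterval × (BaseAnnulus × Circle), Circle)) 0 (by simp [h0])
  obtain ⟨χ, hχ, hχ0⟩ := exists_lift_homotopy
    (⟨fun v => (H v).2 / (f v.2).2, by fun_prop⟩ :
      C(unitInterval × (BaseAnnulus × Circle), Circle)) 0 (by simp [h0])
  simp only [ContinuousMap.coe_mk, ContinuousMap.zero_apply] at hφ hφ0 hχ hχ0
  refine ⟨⟨fun x => θ x + φ (1, x), by fun_prop⟩, ⟨fun x => ψ x + χ (1, x), by fun_prop⟩,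
    fun x => ?_, fun x => ?_, fun j x hx => ⟨h1 x ▸ hH 1 j x hx, ?_⟩⟩
  · simp only [ContinuousMap.coe_mk, Circle.exp_add, hφ, h1]
    rw [← mul_assoc, ← e1, mul_div_cancel]
  · simp only [ContinuousMap.coe_mk, Circle.exp_add, hχ, h1]
    rw [← mul_assoc, ← e2, mul_div_cancel]
  · have hc : Continuous fun t : unitInterval =>
        θ x + φ (t, x) + p * b.angle j x.1.1 - b.angle j (H (t, x)).1.1 := by
      refine Continuous.sub (by fun_prop) ?_
      exact (b.continuousOn_angle j).comp_continuous (by fun_prop) fun t => (hH t j x hx).2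
    have hexp : ∀ t : unitInterval, Circle.exp
        (θ x + φ (t, x) + p * b.angle j x.1.1 - b.angle j (H (t, x)).1.1) = 1 := by
      intro t
      rw [Circle.exp_sub, Circle.exp_add, Circle.exp_add, Circle.exp_intCast_mul, exp_angle,
        exp_angle, hφ, e1, div_eq_one, mul_comm, ← mul_assoc, mul_div_cancel]
    have := eq_of_exp_eq_one isPreconnected_univ hc.continuousOn (fun t _ => hexp t)
      (mem_univ 1) (mem_univ 0)
    simp only [hφ0, h1, h0, add_zero] at this
    simp only [ContinuousMap.coe_mk]
    rw [this, (e3 j x hx).2]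

theorem HasInvariants.of_joined {f g : PairEquivSpace (BaseAnnulus × Circle) b.thick}
    (h : Joined f g) {p k : ℤ} {u : Fin n → ℤ} (hf : b.HasInvariants f.1 p k u) :
    b.HasInvariants g.1 p k u := by
  obtain ⟨P⟩ := h
  have hc : Continuous fun v : unitInterval × (BaseAnnulus × Circle) => (P v.1).1 v.2 := by
    fun_prop
  refine HasInvariants.of_homotopy (H := ⟨_, hc⟩) (f := f.1) (g := g.1) (fun t j x hx => ?_)
    (by simp) (by simp) hf
  exact b.mem_piece_of_isotopic (P t).2.2 hx

/-- All values of the invariants occur. -/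
theorem exists_of_invariants (b : BoundaryArcs n) {p : ℤ} (hp : p * p = 1) (k : ℤ)
    (u : Fin n → ℤ) :
    ∃ f : PairEquivSpace (BaseAnnulus × Circle) b.thick, b.HasInvariants f.1 p k u := by
  -- The map can be chosen to be the identity on `b × S¹`.
  obtain ⟨G, hG⟩ := b.exists_common_extension
    (fun j z => (1 - p) * b.angle j z + 2 * π * u j)
    (fun j => (continuousOn_const.mul (b.continuousOn_angle j)).add continuousOn_const)
  obtain ⟨K, hK⟩ := b.exists_common_extension (fun j z => -k * b.angle j z)
    (fun j => continuousOn_const.mul (b.continuousOn_angle j))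
  let f : C(BaseAnnulus × Circle, BaseAnnulus × Circle) :=
    ⟨fun x => ((x.1.1 ^ p * Circle.exp (G x.1.1), x.1.2),
      x.1.1 ^ k * x.2 * Circle.exp (K x.1.1)), by fun_prop⟩
  have hid : ∀ j, ∀ x ∈ b.piece j, f x = x := by
    rintro j ⟨⟨z, s⟩, w⟩ ⟨hs, hz⟩
    simp only at hs hz
    subst hs
    simp only [f, ContinuousMap.coe_mk, hG j z hz, hK j z hz, Prod.mk.injEq, and_true]
    constructor
    · rw [Circle.exp_add, Circle.exp_two_pi_mul_int, mul_one, sub_mul, Circle.exp_sub,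
        Circle.exp_intCast_mul, one_mul, exp_angle, mul_div_cancel]
    · rw [neg_mul, Circle.exp_neg, Circle.exp_intCast_mul, exp_angle, mul_comm, inv_mul_cancel_left]
  have hinv : b.HasInvariants f p k u := by
    refine ⟨⟨fun x => G x.1.1, by fun_prop⟩, ⟨fun x => K x.1.1, by fun_prop⟩, fun x => rfl,
      fun x => rfl, fun j x hx => ?_⟩
    rw [hid j x hx]
    refine ⟨hx, ?_⟩
    simp only [ContinuousMap.coe_mk, hG j _ hx.2]
    ring
  refine ⟨⟨f, hinv.isSelfHomotopyEquiv hp, ⟨⟨fun v => v.2, by fun_prop⟩,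
    fun _ => (Homeomorph.refl _).isHomeomorph, fun _ => rfl, ?_⟩⟩, hinv⟩
  rintro ⟨x, hx⟩
  rw [thick_eq, mem_iUnion] at hx
  obtain ⟨j, hj⟩ := hx
  exact (hid j x hj).symm

end BoundaryArcs

/-! ### The invariants determine the path component -/

namespace BoundaryArcs

variable {n : ℕ} {b : BoundaryArcs n}

/-- A homotopy through maps that restrict to homeomorphisms isotopic to the identity is a path in
the space that defines `E(X, A)`. -/
theorem joined_of_homotopy {X : Type*} [TopologicalSpace X] [LocallyCompactSpace X] {A : Set X}
    (f g : PairEquivSpace X A) (H : C(unitInterval × X, X)) (h0 : ∀ x, H (0, x) = f.1 x)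
    (h1 : ∀ x, H (1, x) = g.1 x)
    (hA : ∀ t, RestrictsToIsotopicId A ⟨fun x => H (t, x), by fun_prop⟩) : Joined f g := by
  refine ⟨{ toFun := fun t => ⟨H.curry t, ?_, hA t⟩
            continuous_toFun := H.curry.continuous.subtype_mk _
            source' := Subtype.ext (ContinuousMap.ext h0)
            target' := Subtype.ext (ContinuousMap.ext h1) }⟩
  refine f.2.1.of_homotopic ⟨{ toFun := fun v => H (v.1 * t, v.2)
                               continuous_toFun := by fun_prop
                               map_zero_left := by simp [h0]
                               map_one_left := by simp }⟩

/-- A real function on `[0,1] × A`, `A` closed, that vanishes at time `0` extends to a function on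
`[0,1] × X` that vanishes at time `0`. -/
theorem exists_extension_vanishing {X : Type*} [TopologicalSpace X] [NormalSpace X]
    [NormalSpace (unitInterval × X)]
    {A : Set X} (hA : IsClosed A) (φ : C(unitInterval × A, ℝ)) (h0 : ∀ a, φ (0, a) = 0) :
    ∃ Φ : C(unitInterval × X, ℝ), (∀ x, Φ (0, x) = 0) ∧ ∀ t (a : A), Φ (t, a) = φ (t, a) := by
  have he : IsClosedEmbedding (fun v : unitInterval × A => ((v.1, v.2) : unitInterval × X)) :=
    (IsClosedEmbedding.id).prodMap hA.isClosedEmbedding_subtypeVal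
  obtain ⟨Φ, hΦ⟩ := ContinuousMap.exists_extension he φ
  have hΦ' : ∀ t (a : A), Φ (t, a) = φ (t, a) := fun t a => DFunLike.congr_fun hΦ (t, a)
  exact ⟨⟨fun v => Φ v - Φ (0, v.2), by fun_prop⟩, by simp, fun t a => by simp [hΦ', h0]⟩

/-- The homotopy extension property of the pair `(B × S¹, b × S¹)`, for maps to `B × S¹` and
homotopies in `b × S¹`. -/
theorem exists_homotopy_extension (f : C(BaseAnnulus × Circle, BaseAnnulus × Circle))
    (F : C(unitInterval × b.thick, b.thick)) (hF : ∀ a, (F (0, a) : BaseAnnulus × Circle) = f a) :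
    ∃ H : C(unitInterval × (BaseAnnulus × Circle), BaseAnnulus × Circle),
      (∀ x, H (0, x) = f x) ∧ ∀ t (a : b.thick), H (t, a) = F (t, a) := by
  have one : ∀ (c : C(BaseAnnulus × Circle, Circle)) (G : C(unitInterval × b.thick, Circle)),
      (∀ a, G (0, a) = c a) → ∃ K : C(unitInterval × (BaseAnnulus × Circle), Circle),
        (∀ x, K (0, x) = c x) ∧ ∀ t (a : b.thick), K (t, a) = G (t, a) := by
    intro c G h0
    obtain ⟨φ, hφ, hφ0⟩ := exists_lift_homotopy
      (⟨fun v => G v / c v.2, by fun_prop⟩ : C(unitInterval × b.thick, Circle)) 0 (by simp [h0])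
    obtain ⟨Φ, h1, h2⟩ := exists_extension_vanishing b.isClosed_thick φ hφ0
    refine ⟨⟨fun v => c v.2 * Circle.exp (Φ v), by fun_prop⟩, by simp [h1], fun t a => ?_⟩
    simp [h2, hφ]
  obtain ⟨K, hK0, hK⟩ := one ⟨fun x => (f x).1.1, by fun_prop⟩
    ⟨fun v => (F v : BaseAnnulus × Circle).1.1, by fun_prop⟩ (by simp [hF])
  obtain ⟨K', hK0', hK'⟩ := one ⟨fun x => (f x).2, by fun_prop⟩
    ⟨fun v => (F v : BaseAnnulus × Circle).2, by fun_prop⟩ (by simp [hF])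
  -- The interval coordinate is constantly `1` on `b × S¹` and need not be moved.
  refine ⟨⟨fun v => ((K v, (f v.2).1.2), K' v), by fun_prop⟩, fun x => ?_, fun t a => ?_⟩
  · simp [hK0, hK0']
  · have e1 : (f a).1.2 = 1 := by rw [← hF]; exact (F (0, a)).2.1
    have e2 : (F (t, a) : BaseAnnulus × Circle).1.2 = 1 := (F (t, a)).2.1
    ext <;> simp [hK, hK', e1, e2]

/-- Every map of the pair can be deformed to one that fixes `b × S¹` pointwise. -/
theorem exists_joined_fixing (f : PairEquivSpace (BaseAnnulus × Circle) b.thick) :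
    ∃ g : PairEquivSpace (BaseAnnulus × Circle) b.thick, Joined f g ∧ ∀ x ∈ b.thick, g.1 x = x := by
  obtain ⟨F, hF, hF0, hF1⟩ := f.2.2
  obtain ⟨H, hH0, hH⟩ := exists_homotopy_extension f.1
    ⟨fun v => F (unitInterval.symm v.1, v.2), by fun_prop⟩ (by simp [hF1])
  simp only [ContinuousMap.coe_mk] at hH
  have hA : ∀ t, RestrictsToIsotopicId b.thick ⟨fun x => H (t, x), by fun_prop⟩ := fun t =>
    ⟨⟨fun v => F (v.1 * unitInterval.symm t, v.2), by fun_prop⟩,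
      fun s => hF (s * unitInterval.symm t),
      by simp [hF0], by simp [hH]⟩
  let g : PairEquivSpace (BaseAnnulus × Circle) b.thick :=
    ⟨⟨fun x => H (1, x), by fun_prop⟩, f.2.1.of_homotopic
      ⟨{ toFun := H, map_zero_left := hH0, map_one_left := fun x => rfl }⟩, hA 1⟩
  exact ⟨g, joined_of_homotopy f g H hH0 (fun x => rfl) hA, fun x hx =>
    (hH 1 ⟨x, hx⟩).trans (by simp [hF0])⟩

/-- Rotations of the fibres of `b × S¹`, by an angle that does not depend on the point of the
fibre, are homeomorphisms. -/
theorem isHomeomorph_rotation {d : C(BaseAnnulus × Circle, ℝ)}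
    (hd : ∀ j, ∀ x ∈ b.piece j, ∀ y ∈ b.piece j, d x = d y) (t : ℝ)
    (hmem : ∀ a : b.thick, ((a.1.1, a.1.2 * Circle.exp (t * d a)) : BaseAnnulus × Circle) ∈
      b.thick) :
    IsHomeomorph fun a : b.thick => (⟨_, hmem a⟩ : b.thick) := by
  have hd' : ∀ (a : b.thick) (w : Circle), d (a.1.1, w) = d a := by
    rintro ⟨x, hx⟩ w
    rw [thick_eq, mem_iUnion] at hx
    obtain ⟨j, hj⟩ := hx
    exact hd j (x.1, w) hj x hj
  let e : b.thick ≃ₜ b.thick :=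
    { toFun := fun a => ⟨_, hmem a⟩
      invFun := fun a => ⟨(a.1.1, a.1.2 * Circle.exp (-(t * d a))), a.2⟩
      left_inv := fun a => by
        apply Subtype.ext
        simp [hd', mul_assoc]
      right_inv := fun a => by
        apply Subtype.ext
        simp [hd', mul_assoc]
      continuous_toFun := by fun_prop
      continuous_invFun := by fun_prop }
  exact e.isHomeomorph

/-- Maps of the pair with the same invariants lie in the same path component. Once both maps fix
`b × S¹`, the linear homotopy between their lifts is constant on `b × S¹`, up to a rotation of the
fibres of each annulus `bⱼ × S¹`; since such rotations are allowed, the displacements along the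
fibres are not invariants. -/
theorem joined_of_invariants {f g : PairEquivSpace (BaseAnnulus × Circle) b.thick} {p k : ℤ}
    {u : Fin n → ℤ} (hf : b.HasInvariants f.1 p k u) (hg : b.HasInvariants g.1 p k u) :
    Joined f g := by
  obtain ⟨f', hff, hf'⟩ := exists_joined_fixing f
  obtain ⟨g', hgg, hg'⟩ := exists_joined_fixing g
  refine hff.trans (Joined.trans ?_ hgg.symm)
  obtain ⟨θ, ψ, h1, h2, h3⟩ := hf.of_joined hff
  obtain ⟨θ', ψ', h1', h2', h3'⟩ := hg.of_joined hgg
  have hθ : ∀ x ∈ b.thick, θ' x - θ x = 0 := by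
    intro x hx
    have hx' := hx
    rw [thick_eq, mem_iUnion] at hx
    obtain ⟨j, hj⟩ := hx
    have e := (h3 j x hj).2
    have e' := (h3' j x hj).2
    rw [hf' x hx'] at e
    rw [hg' x hx'] at e'
    linarith
  let d : C(BaseAnnulus × Circle, ℝ) := ψ' - ψ
  have hd1 : ∀ x ∈ b.thick, Circle.exp (d x) = 1 := by
    intro x hx
    have e := h2 x
    have e' := h2' x
    rw [hf' x hx] at e
    rw [hg' x hx] at e'
    have := e.symm.trans e'
    simp only [d, ContinuousMap.sub_apply, Circle.exp_sub, div_eq_one]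
    exact (mul_left_cancel this).symm
  have hd : ∀ j, ∀ x ∈ b.piece j, ∀ y ∈ b.piece j, d x = d y := fun j x hx y hy =>
    eq_of_exp_eq_one (b.isPreconnected_piece j) d.continuous.continuousOn
      (fun z hz => hd1 z (b.piece_subset j hz)) hx hy
  have hlin : ∀ (t r s : unitInterval), (unitInterval.symm t : ℝ) * r + t * s ∈ unitInterval :=
    fun t r s => ⟨by have := t.2.1; have := r.2.1; have := s.2.1
                     have := (unitInterval.symm t).2.1; positivity, by
      have ht := t.2; have hr := r.2; have hs := s.2
      rw [unitInterval.coe_symm_eq]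
      nlinarith [ht.1, ht.2, hr.2, hs.2]⟩
  let H : C(unitInterval × (BaseAnnulus × Circle), BaseAnnulus × Circle) :=
    ⟨fun v => (((f'.1 v.2).1.1 * Circle.exp (v.1 * (θ' v.2 - θ v.2)),
      ⟨_, hlin v.1 (f'.1 v.2).1.2 (g'.1 v.2).1.2⟩), (f'.1 v.2).2 * Circle.exp (v.1 * d v.2)),
      by fun_prop⟩
  have hHA : ∀ t, ∀ x ∈ b.thick, H (t, x) = (x.1, x.2 * Circle.exp (t * d x)) := by
    intro t x hx
    have e : x.1.2 = 1 := hx.1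
    simp only [H, ContinuousMap.coe_mk, hf' x hx, hg' x hx, hθ x hx]
    ext <;> simp [e]
  have hmem : ∀ (t : ℝ) (a : b.thick),
      ((a.1.1, a.1.2 * Circle.exp (t * d a)) : BaseAnnulus × Circle) ∈ b.thick :=
    fun t a => a.2
  refine joined_of_homotopy f' g' H (fun x => ?_) (fun x => ?_) fun t => ?_
  · ext <;> simp [H]
  · simp only [H, ContinuousMap.coe_mk, d, ContinuousMap.sub_apply, Icc.coe_one, one_mul,
      Circle.exp_sub, unitInterval.symm_one, Icc.coe_zero, zero_mul, zero_add]
    refine Prod.ext (Prod.ext ?_ rfl) ?_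
    · simp only [h1, h1']
      rw [mul_assoc, mul_div_cancel]
    · simp only [h2, h2']
      rw [mul_assoc, mul_div_cancel]
  · refine ⟨⟨fun v => ⟨_, hmem ((v.1 * t : unitInterval) : ℝ) v.2⟩, by fun_prop⟩, fun s =>
      isHomeomorph_rotation hd (s * t : unitInterval) (hmem _), fun a => ?_, fun a => ?_⟩
    · apply Subtype.ext
      simp
    · simp [hHA t a a.2]

/-! ### The classes with given invariants -/

/-- The class `x` is represented by a map with the invariants `p`, `k`, `u`. -/
def ClassHasInvariants (x : PairMappingClasses (BaseAnnulus × Circle) b.thick) (p k : ℤ)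
    (u : Fin n → ℤ) : Prop :=
  ∃ f, x = PairMappingClasses.mk f ∧ b.HasInvariants f.1 p k u

theorem classHasInvariants_mk {f : PairEquivSpace (BaseAnnulus × Circle) b.thick} {p k : ℤ}
    {u : Fin n → ℤ} : ClassHasInvariants (PairMappingClasses.mk f) p k u ↔
      b.HasInvariants f.1 p k u := by
  constructor
  · rintro ⟨g, h, hg⟩
    exact hg.of_joined (Quotient.exact h.symm)
  · exact fun h => ⟨f, rfl, h⟩

theorem exists_classHasInvariants [NeZero n]
    (x : PairMappingClasses (BaseAnnulus × Circle) b.thick) :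
    ∃ p k u, p * p = 1 ∧ ClassHasInvariants x p k u := by
  obtain ⟨f, rfl⟩ := Quotient.exists_rep x
  obtain ⟨p, k, u, hp, h⟩ := exists_hasInvariants f.2.1 f.2.2
  exact ⟨p, k, u, hp, f, rfl, h⟩

theorem exists_class (b : BoundaryArcs n) {p : ℤ} (hp : p * p = 1) (k : ℤ) (u : Fin n → ℤ) :
    ∃ x : PairMappingClasses (BaseAnnulus × Circle) b.thick, ClassHasInvariants x p k u := by
  obtain ⟨f, hf⟩ := exists_of_invariants b hp k u
  exact ⟨_, f, rfl, hf⟩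

theorem ClassHasInvariants.mul {x y : PairMappingClasses (BaseAnnulus × Circle) b.thick}
    {p k p' k' : ℤ} {u u' : Fin n → ℤ} (hx : ClassHasInvariants x p k u)
    (hy : ClassHasInvariants y p' k' u') :
    ClassHasInvariants (x * y) (p * p') (k * p' + k') (fun j => u j + p * u' j) := by
  obtain ⟨f, rfl, hf⟩ := hx
  obtain ⟨g, rfl, hg⟩ := hy
  exact ⟨f * g, rfl, hf.comp hg⟩

variable (b) in
theorem classHasInvariants_one :
    ClassHasInvariants (1 : PairMappingClasses (BaseAnnulus × Circle) b.thick) 1 0 (fun _ => 0) :=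
  ⟨1, rfl, b.hasInvariants_id⟩

theorem ClassHasInvariants.unique {x : PairMappingClasses (BaseAnnulus × Circle) b.thick}
    {p k p' k' : ℤ} {u u' : Fin n → ℤ} (h : ClassHasInvariants x p k u)
    (h' : ClassHasInvariants x p' k' u') :
    p = p' ∧ k = k' ∧ ∃ c : ℤ, ∀ j, u j = u' j + c := by
  obtain ⟨f, rfl, hf⟩ := h
  exact hf.unique (classHasInvariants_mk.1 h')

theorem ClassHasInvariants.eq {x y : PairMappingClasses (BaseAnnulus × Circle) b.thick}
    {p k : ℤ} {u u' : Fin n → ℤ} (hx : ClassHasInvariants x p k u)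
    (hy : ClassHasInvariants y p k u') (c : ℤ) (hu : ∀ j, u' j = u j + c) : x = y := by
  obtain ⟨f, rfl, hf⟩ := hx
  obtain ⟨g, rfl, hg⟩ := hy
  rw [show u' = fun j => u j + c from funext hu] at hg
  exact Quotient.sound (joined_of_invariants (hf.add_const c) hg)

/-- `E(B × S¹, b × S¹)` is a group. -/
theorem isUnit_class [NeZero n] (x : PairMappingClasses (BaseAnnulus × Circle) b.thick) :
    IsUnit x := by
  obtain ⟨p, k, u, hp, hx⟩ := exists_classHasInvariants x
  obtain ⟨y, hy⟩ := exists_class b hp (-(k * p)) (fun j => -(p * u j))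
  refine isUnit_iff_exists.2 ⟨y, ?_, ?_⟩
  · have h := hx.mul hy
    rw [hp] at h
    simp only [add_neg_cancel] at h
    exact h.eq (classHasInvariants_one b) 0 fun j => by linear_combination (u j) * hp
  · have h := hy.mul hx
    rw [hp, show -(k * p) * p + k = 0 by linear_combination -k * hp] at h
    exact h.eq (classHasInvariants_one b) 0 fun j => by ring

end BoundaryArcs

/-! ### Transport along a homeomorphism -/

section Conj

variable {X Y : Type*} [TopologicalSpace X] [TopologicalSpace Y]

/-- The self-map of `Y` that corresponds to a self-map of `X` under a homeomorphism. -/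
def conjMap (e : X ≃ₜ Y) (f : C(X, X)) : C(Y, Y) := ⟨fun y => e (f (e.symm y)), by fun_prop⟩

theorem conjMap_conjMap_symm (e : X ≃ₜ Y) (f : C(X, X)) : conjMap e.symm (conjMap e f) = f := by
  ext x; simp [conjMap]

theorem ContinuousMap.Homotopic.conjMap (e : X ≃ₜ Y) {f g : C(X, X)} (h : f.Homotopic g) :
    (conjMap e f).Homotopic (conjMap e g) :=
  ((ContinuousMap.Homotopic.refl (e : C(X, Y))).comp h).comp
    (ContinuousMap.Homotopic.refl (e.symm : C(Y, X)))

theorem IsSelfHomotopyEquiv.conjMap (e : X ≃ₜ Y) {f : C(X, X)} (h : IsSelfHomotopyEquiv f) :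
    IsSelfHomotopyEquiv (conjMap e f) := by
  obtain ⟨g, h1, h2⟩ := h
  refine ⟨_root_.conjMap e g, ?_, ?_⟩
  · convert h1.conjMap e using 1 <;> ext y <;> simp [_root_.conjMap]
  · convert h2.conjMap e using 1 <;> ext y <;> simp [_root_.conjMap]

theorem RestrictsToIsotopicId.conjMap (e : X ≃ₜ Y) {A : Set X} {A' : Set Y}
    (hA : ∀ x, x ∈ A ↔ e x ∈ A') {f : C(X, X)} (h : RestrictsToIsotopicId A f) :
    RestrictsToIsotopicId A' (conjMap e f) := by
  obtain ⟨F, h0, h1, h2⟩ := h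
  let r : A ≃ₜ A' := e.subtype hA
  refine ⟨⟨fun v => r (F (v.1, r.symm v.2)), by fun_prop⟩, fun t => ?_, fun a => ?_, fun a => ?_⟩
  · exact r.isHomeomorph.comp ((h0 t).comp r.symm.isHomeomorph)
  · simp [h1]
  · have e1 : ∀ x : A, ((r x : A') : Y) = e x := fun _ => rfl
    have e2 : ((r.symm a : A) : X) = e.symm a := rfl
    simp [_root_.conjMap, e1, h2, e2]

/-- Conjugation by a homeomorphism of pairs. -/
def PairEquivSpace.conj (e : X ≃ₜ Y) {A : Set X} {A' : Set Y} (hA : ∀ x, x ∈ A ↔ e x ∈ A')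
    (f : PairEquivSpace X A) : PairEquivSpace Y A' :=
  ⟨conjMap e f.1, f.2.1.conjMap e, f.2.2.conjMap e hA⟩

theorem PairEquivSpace.continuous_conj (e : X ≃ₜ Y) {A : Set X} {A' : Set Y}
    (hA : ∀ x, x ∈ A ↔ e x ∈ A') : Continuous (PairEquivSpace.conj e hA) :=
  Continuous.subtype_mk (((e : C(X, Y)).continuous_postcomp.comp
    ((e.symm : C(Y, X)).continuous_precomp)).comp continuous_subtype_val) _

/-- A homeomorphism of pairs induces an isomorphism of the monoids `E(X, A)`. -/
def PairMappingClasses.congr [LocallyCompactSpace X] [LocallyCompactSpace Y] (e : X ≃ₜ Y)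
    {A : Set X} {A' : Set Y} (hA : ∀ x, x ∈ A ↔ e x ∈ A') :
    PairMappingClasses X A ≃* PairMappingClasses Y A' where
  toFun := Quotient.map (PairEquivSpace.conj e hA)
    fun _ _ h => h.map (PairEquivSpace.continuous_conj e hA)
  invFun := Quotient.map (PairEquivSpace.conj e.symm fun y => by simp [hA])
    fun _ _ h => h.map (PairEquivSpace.continuous_conj e.symm _)
  left_inv := by
    rintro ⟨f⟩
    exact congrArg PairMappingClasses.mk (Subtype.ext (conjMap_conjMap_symm e f.1))
  right_inv := by
    rintro ⟨f⟩
    exact congrArg PairMappingClasses.mk (Subtype.ext (conjMap_conjMap_symm e.symm f.1))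
  map_mul' := by
    rintro ⟨f⟩ ⟨g⟩
    refine congrArg PairMappingClasses.mk (Subtype.ext (ContinuousMap.ext fun y => ?_))
    change e (f.1 (g.1 (e.symm y))) = e (f.1 (e.symm (e (g.1 (e.symm y)))))
    simp

theorem PairMappingClasses.congr_mk [LocallyCompactSpace X] [LocallyCompactSpace Y] (e : X ≃ₜ Y)
    {A : Set X} {A' : Set Y} (hA : ∀ x, x ∈ A ↔ e x ∈ A') (f : PairEquivSpace X A) :
    PairMappingClasses.congr e hA (mk f) = mk (PairEquivSpace.conj e hA f) := rfl

end Conj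

/-! ### The subgroup `E₀` -/

namespace BoundaryArcs

/-- A map of degree `p = ±1` on the base induces the identity on the fundamental group of the
base if and only if `p = 1`. -/
theorem inducesIdOnLoops_iff {q : C(BaseAnnulus, BaseAnnulus)} {p : ℤ} {θ : C(BaseAnnulus, ℝ)}
    (h : ∀ x, (q x).1 = x.1 ^ p * Circle.exp (θ x)) :
    InducesIdOnLoops q ↔ p = 1 := by
  constructor
  · intro hq
    have h1 := hq (coreCircle (ContinuousMap.id Circle))
    obtain ⟨φ, hφ⟩ := exists_angle_of_homotopic
      ((ContinuousMap.Homotopic.refl (ContinuousMap.fst : C(BaseAnnulus, Circle))).comp h1)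
    refine circle_form_unique (θ := ⟨fun w => θ (coreCircle (ContinuousMap.id Circle) w) + φ w,
      by fun_prop⟩) (θ' := 0) fun w => ?_
    have := hφ w
    simp only [ContinuousMap.comp_apply, h, ContinuousMap.fst_apply] at this
    simp only [ContinuousMap.coe_mk, Circle.exp_add, zpow_one, ContinuousMap.zero_apply,
      Circle.exp_zero, mul_one]
    rw [← mul_assoc]
    exact this.symm
  · rintro rfl δ
    refine (homotopic_of_angle (θ.comp δ) fun y => ?_).symm
    simp [h]

variable {m : ℕ} {b : BoundaryArcs (m + 1)}

theorem eq_neg_one_of_mul_self {p : ℤ} (hp : p * p = 1) (h : p ≠ 1) : p = -1 :=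
  (mul_self_eq_one_iff.1 hp).resolve_left h

/-- The structure of a group of units that is identified with `E(B × S¹, b × S¹)`: the classes with
`p = 1` form a subgroup of index two, which is free abelian on any classes with the invariants
of the sweeps and of a Dehn twist. -/
theorem exists_subgroup {E : Type*} [Monoid E]
    (ε : E ≃* PairMappingClasses (BaseAnnulus × Circle) b.thick) :
    ∃ E₀ : Subgroup Eˣ, E₀.index = 2 ∧
      (∀ (v : Eˣ) (p k : ℤ) (u : Fin (m + 1) → ℤ), ClassHasInvariants (ε v) p k u →
        (v ∈ E₀ ↔ p = 1)) ∧
      ∀ σ : Fin (m + 1) → ℤ, (∀ j, σ j * σ j = 1) →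
        ∃ φ : Multiplicative (Fin (m + 1) → ℤ) ≃* E₀, ∀ e : Fin (m + 1) → ℤ,
          ClassHasInvariants (ε ((φ (Multiplicative.ofAdd e) : Eˣ) : E)) 1
            (σ (Fin.last m) * e (Fin.last m))
            (fun j => if j = Fin.last m then 0 else σ j * e j) := by
  have hunit : ∀ y : PairMappingClasses (BaseAnnulus × Circle) b.thick, ∃ v : Eˣ, ε v = y := by
    intro y
    have : IsUnit (ε.symm y) := (isUnit_class y).map ε.symm
    exact ⟨this.unit, by simp⟩
  let E₀ : Subgroup Eˣ :=
    { carrier := {v | ∃ k u, ClassHasInvariants (ε v) 1 k u}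
      one_mem' := ⟨0, _, by simpa using classHasInvariants_one b⟩
      mul_mem' := by
        rintro v w ⟨k, u, h⟩ ⟨k', u', h'⟩
        exact ⟨_, _, by simpa using h.mul h'⟩
      inv_mem' := by
        rintro v ⟨k, u, h⟩
        obtain ⟨p', k', u', -, h'⟩ := exists_classHasInvariants (ε ((v⁻¹ : Eˣ) : E))
        have h1 := h.mul h'
        rw [← map_mul, Units.mul_inv, map_one] at h1
        obtain ⟨e, -, -⟩ := h1.unique (classHasInvariants_one b)
        rw [one_mul] at e
        subst e
        exact ⟨k', u', h'⟩ }
  have hE₀ : ∀ (v : Eˣ) (p k : ℤ) (u : Fin (m + 1) → ℤ), ClassHasInvariants (ε v) p k u →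
      (v ∈ E₀ ↔ p = 1) := by
    intro v p k u h
    constructor
    · rintro ⟨k', u', h'⟩
      exact (h.unique h').1
    · rintro rfl
      exact ⟨k, u, h⟩
  refine ⟨E₀, ?_, hE₀, fun σ hσ => ?_⟩
  · rw [Subgroup.index_eq_two_iff]
    obtain ⟨y, hy⟩ := exists_class b (p := -1) (by norm_num) 0 (fun _ => 0)
    obtain ⟨a, rfl⟩ := hunit y
    refine ⟨a, fun v => ?_⟩
    obtain ⟨p, k, u, hp, h⟩ := exists_classHasInvariants (ε (v : E))
    have h' := h.mul hy
    rw [← map_mul, ← Units.val_mul] at h'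
    rw [hE₀ _ _ _ _ h, hE₀ _ _ _ _ h']
    by_cases h1 : p = 1
    · subst h1; right; norm_num
    · rw [eq_neg_one_of_mul_self hp h1]; left; norm_num
  · have hex : ∀ e : Fin (m + 1) → ℤ, ∃ v : E₀, ClassHasInvariants (ε ((v : Eˣ) : E)) 1
        (σ (Fin.last m) * e (Fin.last m))
        (fun j => if j = Fin.last m then 0 else σ j * e j) := by
      intro e
      obtain ⟨y, hy⟩ := exists_class b (p := 1) (by norm_num) (σ (Fin.last m) * e (Fin.last m))
        (fun j => if j = Fin.last m then 0 else σ j * e j)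
      obtain ⟨v, rfl⟩ := hunit y
      exact ⟨⟨v, _, _, hy⟩, hy⟩
    have hinj : ∀ (v w : E₀) (k : ℤ) (u : Fin (m + 1) → ℤ) (u' : Fin (m + 1) → ℤ) (c : ℤ),
        ClassHasInvariants (ε ((v : Eˣ) : E)) 1 k u →
        ClassHasInvariants (ε ((w : Eˣ) : E)) 1 k u' → (∀ j, u' j = u j + c) → v = w :=
      fun v w k u u' c hv hw hc =>
        Subtype.ext (Units.ext (ε.injective (hv.eq hw c hc)))
    choose φ hφ using hex
    let φ' : Multiplicative (Fin (m + 1) → ℤ) →* E₀ :=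
      MonoidHom.mk' (fun e => φ e.toAdd) fun e e' => by
        have h1 := (hφ e.toAdd).mul (hφ e'.toAdd)
        rw [← map_mul, ← Units.val_mul, ← Subgroup.coe_mul] at h1
        simp only [mul_one, one_mul] at h1
        have h2 := hφ (e * e').toAdd
        rw [toAdd_mul, Pi.add_apply, mul_add] at h2
        refine hinj _ _ _ _ _ 0 h2 h1 fun j => ?_
        by_cases hj : j = Fin.last m <;> simp [hj, mul_add]
    have hbij : Function.Bijective φ' := by
      constructor
      · intro e e' h
        have h1 := hφ e.toAdd
        have h2 := hφ e'.toAdd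
        change φ e.toAdd = φ e'.toAdd at h
        rw [← h] at h2
        obtain ⟨-, hk, c, hc⟩ := h1.unique h2
        have h0 := hc (Fin.last m)
        simp only [if_true, zero_add] at h0
        have hcancel : ∀ j x y, σ j * x = σ j * y → x = y := by
          intro j x y hxy
          have := congrArg (σ j * ·) hxy
          simpa only [← mul_assoc, hσ, one_mul] using this
        refine Multiplicative.toAdd.injective (funext fun j => hcancel j _ _ ?_)
        by_cases hj : j = Fin.last m
        · rw [hj]; exact hk
        · simpa [hj, ← h0] using hc j
      · intro v
        obtain ⟨k, u, h⟩ := v.2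
        refine ⟨Multiplicative.ofAdd fun j => if j = Fin.last m then σ j * k else
          σ j * (u j - u (Fin.last m)), ?_⟩
        have h1 := hφ fun j => if j = Fin.last m then σ j * k else σ j * (u j - u (Fin.last m))
        simp only [if_true, ← mul_assoc, hσ, one_mul] at h1
        refine hinj _ _ _ _ _ (u (Fin.last m)) h1 h fun j => ?_
        by_cases hj : j = Fin.last m
        · simp [hj]
        · simp [hj, ← mul_assoc, hσ]
    exact ⟨MulEquiv.ofBijective φ' hbij, fun e => hφ e⟩

end BoundaryArcs

/-! ### The complement of an arc of `b` in the circle -/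

namespace BoundaryArcs

variable {n : ℕ} (b : BoundaryArcs n)

/-- The angle on the complement of the arc `bⱼ`, with values in `(hi j, lo j + 2π)`. -/
noncomputable def coangle (j : Fin n) (z : Circle) : ℝ := angleAt ((b.lo j + b.hi j) / 2 + π) z

@[simp] theorem exp_coangle (j : Fin n) (z : Circle) : Circle.exp (b.coangle j z) = z :=
  exp_angleAt _ _

theorem coangle_exp (j : Fin n) {x : ℝ} (hx : x ∈ Icc (b.hi j) (b.lo j + 2 * π)) :
    b.coangle j (Circle.exp x) = x := by
  have := b.lo_lt_hi j
  exact angleAt_exp (by linarith [hx.1]) (by linarith [hx.2])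

theorem exp_mem_range_arc (j : Fin n) {x : ℝ} (hx : x ∈ Icc (b.lo j) (b.hi j)) :
    Circle.exp x ∈ range (b.arc j) := by
  rw [range_arc]; exact mem_image_of_mem _ hx

theorem coangle_mem (j : Fin n) {z : Circle} (hz : z ∉ range (b.arc j)) :
    b.coangle j z ∈ Ioo (b.hi j) (b.lo j + 2 * π) := by
  have h := angleAt_mem ((b.lo j + b.hi j) / 2 + π) z
  rw [← coangle] at h
  have hlt := b.lo_lt_hi j
  constructor
  · by_contra! hle
    exact hz (b.exp_coangle j z ▸ b.exp_mem_range_arc j ⟨by linarith [h.1], hle⟩)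
  · by_contra! hle
    refine hz ?_
    rw [← b.exp_coangle j z, ← Circle.exp_sub_two_pi]
    exact b.exp_mem_range_arc j ⟨by linarith, by linarith [h.2]⟩

theorem exp_notMem_range_arc (j : Fin n) {x : ℝ} (hx : x ∈ Ioo (b.hi j) (b.lo j + 2 * π)) :
    Circle.exp x ∉ range (b.arc j) := by
  rw [range_arc]
  rintro ⟨y, hy, h⟩
  obtain ⟨c, rfl⟩ := Circle.exp_eq_exp.1 h.symm
  have h1 : (0 : ℝ) < c * (2 * π) := by linarith [hx.1, hy.2]
  have h2 : (c : ℝ) * (2 * π) < 1 * (2 * π) := by linarith [hx.2, hy.1]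
  have h3 : (0 : ℝ) < c := pos_of_mul_pos_left h1 two_pi_pos.le
  have h4 : (c : ℝ) < 1 := lt_of_mul_lt_mul_right h2 two_pi_pos.le
  norm_cast at h3 h4
  lia

theorem continuousOn_coangle (j : Fin n) : ContinuousOn (b.coangle j) (range (b.arc j))ᶜ := by
  intro z hz
  refine (continuousAt_angleAt ?_).continuousWithinAt
  have := (b.coangle_mem j hz).2
  rw [coangle] at this
  have := b.lo_lt_hi j
  apply ne_of_lt
  linarith

/-- A connected set that avoids `bⱼ` corresponds to an order-connected set of angles. -/
theorem exp_mem_of_isPreconnected (j : Fin n) {S : Set Circle} (hS : IsPreconnected S)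
    (hj : Disjoint S (range (b.arc j))) {z z' : Circle} (hz : z ∈ S) (hz' : z' ∈ S) {y : ℝ}
    (h : b.coangle j z ≤ y) (h' : y ≤ b.coangle j z') : Circle.exp y ∈ S := by
  have hp := hS.image _ ((b.continuousOn_coangle j).mono
    (Set.disjoint_left.1 hj : S ⊆ (range (b.arc j))ᶜ))
  obtain ⟨s, hs, rfl⟩ := hp.ordConnected.out (mem_image_of_mem _ hz) (mem_image_of_mem _ hz')
    ⟨h, h'⟩
  rwa [exp_coangle]

theorem gap_subset (q : Circle) : b.gap q ⊆ b.unionᶜ := connectedComponentIn_subset _ _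

theorem disjoint_gap (j : Fin n) (q : Circle) : Disjoint (b.gap q) (range (b.arc j)) :=
  Set.disjoint_left.2 fun _ hz hj => b.gap_subset q hz (b.range_arc_subset j hj)

theorem isPreconnected_gap (q : Circle) : IsPreconnected (b.gap q) :=
  isPreconnected_connectedComponentIn

/-- A gap that is adjacent to `bⱼ` contains everything between any of its points and `bⱼ`, on one
of the two sides. -/
theorem gap_adjacent {j : Fin n} {q : Circle} (hq : q ∉ b.union)
    (h : (closure (b.gap q) ∩ range (b.arc j)).Nonempty) :
    (∀ y ∈ Ioo (b.hi j) (b.coangle j q), Circle.exp y ∈ b.gap q) ∨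
      ∀ y ∈ Ioo (b.coangle j q) (b.lo j + 2 * π), Circle.exp y ∈ b.gap q := by
  by_contra! hcon
  obtain ⟨⟨y₁, hy₁, h₁⟩, ⟨y₂, hy₂, h₂⟩⟩ := hcon
  have hqj : q ∉ range (b.arc j) := fun h => hq (b.range_arc_subset j h)
  have hqm := b.coangle_mem j hqj
  have hqg : q ∈ b.gap q := mem_connectedComponentIn hq
  have hsub : b.gap q ⊆ Circle.exp '' Icc y₁ y₂ := by
    intro z hz
    refine ⟨b.coangle j z, ⟨?_, ?_⟩, b.exp_coangle j z⟩
    · by_contra! hlt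
      exact h₁ (b.exp_mem_of_isPreconnected j (b.isPreconnected_gap q) (b.disjoint_gap j q) hz hqg
        hlt.le hy₁.2.le)
    · by_contra! hlt
      exact h₂ (b.exp_mem_of_isPreconnected j (b.isPreconnected_gap q) (b.disjoint_gap j q) hqg hz
        hy₂.1.le hlt.le)
  have hcl : IsClosed (Circle.exp '' Icc y₁ y₂) :=
    (isCompact_Icc.image Circle.exp.continuous).isClosed
  obtain ⟨z, hz, hzj⟩ := h
  obtain ⟨y, hy, rfl⟩ := closure_minimal hsub hcl hz
  exact b.exp_notMem_range_arc j ⟨hy₁.1.trans_le hy.1, hy.2.trans_lt hy₂.2⟩ hzj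

/-- If two different gaps are adjacent to `bⱼ`, then all other arcs lie between them. -/
theorem coangle_between {j : Fin n} {q q' : Circle} (hq : q ∉ b.union) (hq' : q' ∉ b.union)
    (h : (closure (b.gap q) ∩ range (b.arc j)).Nonempty)
    (h' : (closure (b.gap q') ∩ range (b.arc j)).Nonempty) (hne : b.gap q ≠ b.gap q')
    (hlt : b.coangle j q < b.coangle j q') {i : Fin n} (hij : i ≠ j) {z : Circle}
    (hz : z ∈ range (b.arc i)) : b.coangle j q < b.coangle j z ∧
      b.coangle j z < b.coangle j q' := by
  have hqm := b.coangle_mem j fun h => hq (b.range_arc_subset j h)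
  have hqm' := b.coangle_mem j fun h => hq' (b.range_arc_subset j h)
  have hzj : z ∉ range (b.arc j) := Set.disjoint_left.1 (b.arc_disjoint i j hij) hz
  have hzm := b.coangle_mem j hzj
  have hzu := b.range_arc_subset i hz
  have hz1 : z ∉ b.gap q := fun hm => b.gap_subset q hm hzu
  have hz2 : z ∉ b.gap q' := fun hm => b.gap_subset q' hm hzu
  have e1 : ∀ y ∈ Ioo (b.hi j) (b.coangle j q), Circle.exp y ∈ b.gap q := by
    refine (b.gap_adjacent hq h).resolve_right fun hall => hne ?_
    have := hall _ ⟨hlt, hqm'.2⟩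
    rw [exp_coangle] at this
    exact connectedComponentIn_eq this
  have e2 : ∀ y ∈ Ioo (b.coangle j q') (b.lo j + 2 * π), Circle.exp y ∈ b.gap q' := by
    refine (b.gap_adjacent hq' h').resolve_left fun hall => hne ?_
    have := hall _ ⟨hqm.1, hlt⟩
    rw [exp_coangle] at this
    exact (connectedComponentIn_eq this).symm
  constructor
  · refine lt_of_le_of_ne (not_lt.1 fun hl => ?_) fun he => ?_
    · exact hz1 (b.exp_coangle j z ▸ e1 _ ⟨hzm.1, hl⟩)
    · have : q = z := by rw [← b.exp_coangle j q, he, exp_coangle]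
      exact hq (this ▸ hzu)
  · refine lt_of_le_of_ne (not_lt.1 fun hl => ?_) fun he => ?_
    · exact hz2 (b.exp_coangle j z ▸ e2 _ ⟨hl, hzm.2⟩)
    · have : q' = z := by rw [← b.exp_coangle j q', ← he, exp_coangle]
      exact hq' (this ▸ hzu)

/-- Let `Ψ` be a function of the angle that takes values in `2πℤ` on `[A, C]` outside of an
interval, which is parametrized by `ρ`. The change of `Ψ` over `[A, C]` is, up to a sign that does
not depend on `C`, its change over the interval. -/
theorem jump_across {Ψ ρ : ℝ → ℝ} {A : ℝ} (hΨ : Continuous Ψ)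
    (hρ : ContinuousOn ρ (Icc (-1) 1)) (hinj : InjOn ρ (Icc (-1) 1)) :
    ∃ κ : ℝ, (κ = 1 ∨ κ = -1) ∧ ∀ C, (∀ r ∈ Icc (-1 : ℝ) 1, ρ r ∈ Icc A C) →
      (∀ x ∈ Icc A C, (∀ r ∈ Ioo (-1 : ℝ) 1, x ≠ ρ r) → Circle.exp (Ψ x) = 1) →
      Ψ C - Ψ A = κ * (Ψ (ρ 1) - Ψ (ρ (-1))) := by
  have main : ∀ e e' : ℝ, e ∈ Icc (-1 : ℝ) 1 → e' ∈ Icc (-1 : ℝ) 1 →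
      (∀ r ∈ Ioo (-1 : ℝ) 1, ρ e < ρ r ∧ ρ r < ρ e') → ∀ C,
      (∀ r ∈ Icc (-1 : ℝ) 1, ρ r ∈ Icc A C) →
      (∀ x ∈ Icc A C, (∀ r ∈ Ioo (-1 : ℝ) 1, x ≠ ρ r) → Circle.exp (Ψ x) = 1) →
      Ψ C - Ψ A = Ψ (ρ e') - Ψ (ρ e) := by
    intro e e' he he' hr C hmem h1
    have hA : Ψ A = Ψ (ρ e) :=
      eq_of_exp_eq_one (S := Icc A (ρ e)) isPreconnected_Icc hΨ.continuousOn
        (fun y hy => h1 y ⟨hy.1, hy.2.trans (hmem e he).2⟩ fun r hr' hyr => by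
          have := (hr r hr').1; rw [← hyr] at this; exact absurd hy.2 this.not_ge)
        ⟨le_rfl, (hmem e he).1⟩ ⟨(hmem e he).1, le_rfl⟩
    have hC : Ψ C = Ψ (ρ e') :=
      eq_of_exp_eq_one (S := Icc (ρ e') C) isPreconnected_Icc hΨ.continuousOn
        (fun y hy => h1 y ⟨(hmem e' he').1.trans hy.1, hy.2⟩ fun r hr' hyr => by
          have := (hr r hr').2; rw [← hyr] at this; exact absurd hy.1 this.not_ge)
        ⟨(hmem e' he').2, le_rfl⟩ ⟨le_rfl, (hmem e' he').2⟩
    rw [hA, hC]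
  have l : (-1 : ℝ) ∈ Icc (-1 : ℝ) 1 := by norm_num
  have r : (1 : ℝ) ∈ Icc (-1 : ℝ) 1 := by norm_num
  rcases hρ.strictMonoOn_of_injOn_Icc' (by norm_num) hinj with hm | hm
  · refine ⟨1, Or.inl rfl, fun C hmem h1 => ?_⟩
    rw [main (-1) 1 l r (fun s hs =>
      ⟨hm l (Ioo_subset_Icc_self hs) hs.1, hm (Ioo_subset_Icc_self hs) r hs.2⟩) C hmem h1]
    ring
  · refine ⟨-1, Or.inr rfl, fun C hmem h1 => ?_⟩
    rw [main 1 (-1) r l (fun s hs =>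
      ⟨hm (Ioo_subset_Icc_self hs) r hs.2, hm l (Ioo_subset_Icc_self hs) hs.1⟩) C hmem h1]
    ring

/-- A continuous function on the circle `∂₁B` that takes values in `2πℤ` outside of two intervals
`c` and `c'`, contained in the two different gaps adjacent to `bⱼ`, and that changes by `δ` along
each of them, has the same value on all other arcs, which differs by `±δ` from its value
on `bⱼ`. The opposite directions of the two ends are irrelevant: the value on `bⱼ` and the change
along one of the intervals determine the value on the other arcs. -/
theorem exists_sign_of_jump {j : Fin n} {Ψ : C(Circle, ℝ)} {c c' : ℝ → Circle} {δ : ℝ}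
    (hc : ContinuousOn c (Icc (-1) 1)) (hc' : ContinuousOn c' (Icc (-1) 1))
    (hi : InjOn c (Icc (-1) 1)) (hi' : InjOn c' (Icc (-1) 1))
    (hu : ∀ r ∈ Icc (-1 : ℝ) 1, c r ∉ b.union) (hu' : ∀ r ∈ Icc (-1 : ℝ) 1, c' r ∉ b.union)
    (ha : (closure (b.gap (c 0)) ∩ range (b.arc j)).Nonempty)
    (ha' : (closure (b.gap (c' 0)) ∩ range (b.arc j)).Nonempty)
    (hne : b.gap (c 0) ≠ b.gap (c' 0))
    (hΨ : ∀ z, (∀ r ∈ Ioo (-1 : ℝ) 1, z ≠ c r) → (∀ r ∈ Ioo (-1 : ℝ) 1, z ≠ c' r) →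
      Circle.exp (Ψ z) = 1)
    (hδ : Ψ (c 1) - Ψ (c (-1)) = δ) (hδ' : Ψ (c' 1) - Ψ (c' (-1)) = δ) :
    ∃ κ : ℝ, (κ = 1 ∨ κ = -1) ∧ ∀ i, i ≠ j → ∀ z ∈ range (b.arc i), ∀ z' ∈ range (b.arc j),
      Ψ z - Ψ z' = κ * δ := by
  have hz0 : (0 : ℝ) ∈ Icc (-1 : ℝ) 1 := by norm_num
  -- The claim is symmetric in `c` and `c'`, and it suffices to consider the first of the two gaps.
  wlog hlt : b.coangle j (c 0) < b.coangle j (c' 0) generalizing c c'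
  · refine this hc' hc hi' hi hu' hu ha' ha hne.symm (fun z h h' => hΨ z h' h) hδ' hδ ?_
    refine lt_of_le_of_ne (not_lt.1 hlt) fun he => hne ?_
    rw [← b.exp_coangle j (c 0), ← he, exp_coangle]
  have hcont : ∀ {d : ℝ → Circle}, ContinuousOn d (Icc (-1) 1) →
      (∀ r ∈ Icc (-1 : ℝ) 1, d r ∉ b.union) →
      ContinuousOn (fun r => b.coangle j (d r)) (Icc (-1) 1) := fun hd hu =>
    (b.continuousOn_coangle j).comp hd fun r hr h => hu r hr (b.range_arc_subset j h)
  obtain ⟨κ, hκ, hjump⟩ := jump_across (Ψ := fun x => Ψ (Circle.exp x))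
    (ρ := fun r => b.coangle j (c r)) (A := b.hi j) (by fun_prop) (hcont hc hu)
    (fun r hr s hs h => hi hr hs (by
      rw [← b.exp_coangle j (c r), ← b.exp_coangle j (c s)]; exact congrArg _ h))
  refine ⟨κ, hκ, ?_⟩
  intro i hij z hz z' hz'
  obtain ⟨hb, hb'⟩ := b.coangle_between (hu 0 hz0) (hu' 0 hz0) ha ha' hne hlt hij hz
  have hzj : z ∉ range (b.arc j) := Set.disjoint_left.1 (b.arc_disjoint i j hij) hz
  have hzm := b.coangle_mem j hzj
  have hnot : ∀ {d : ℝ → Circle}, (∀ r ∈ Icc (-1 : ℝ) 1, d r ∉ b.union) →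
      ∀ r ∈ Icc (-1 : ℝ) 1, b.coangle j (d r) ≠ b.coangle j z := by
    intro d hu r hr he
    have : d r = z := by rw [← b.exp_coangle j (d r), he, exp_coangle]
    exact hu r hr (this ▸ b.range_arc_subset i hz)
  have hbelow : ∀ r ∈ Icc (-1 : ℝ) 1, b.coangle j (c r) < b.coangle j z := by
    intro r hr
    by_contra! hge
    obtain ⟨s, hs, hse⟩ := (isPreconnected_Icc.image _ (hcont hc hu)).ordConnected.out
      (mem_image_of_mem _ hz0) (mem_image_of_mem _ hr) ⟨hb.le, hge⟩
    exact hnot hu s hs hse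
  have habove : ∀ r ∈ Icc (-1 : ℝ) 1, b.coangle j z < b.coangle j (c' r) := by
    intro r hr
    by_contra! hge
    obtain ⟨s, hs, hse⟩ := (isPreconnected_Icc.image _ (hcont hc' hu')).ordConnected.out
      (mem_image_of_mem _ hr) (mem_image_of_mem _ hz0) ⟨hge, hb'.le⟩
    exact hnot hu' s hs hse
  have hcm : ∀ r ∈ Icc (-1 : ℝ) 1, b.coangle j (c r) ∈ Ioo (b.hi j) (b.lo j + 2 * π) :=
    fun r hr => b.coangle_mem j fun h => hu r hr (b.range_arc_subset j h)
  -- `Ψ` is constant on the arc `bⱼ`, which the intervals avoid.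
  have hΨj : ∀ y ∈ range (b.arc j), Circle.exp (Ψ y) = 1 := fun y hy =>
    hΨ y (fun r hr he => hu r (Ioo_subset_Icc_self hr) (he ▸ b.range_arc_subset j hy))
      (fun r hr he => hu' r (Ioo_subset_Icc_self hr) (he ▸ b.range_arc_subset j hy))
  have hhi : Circle.exp (b.hi j) ∈ range (b.arc j) :=
    b.exp_mem_range_arc j ⟨(b.lo_lt_hi j).le, le_rfl⟩
  have hz'e : Ψ z' = Ψ (Circle.exp (b.hi j)) :=
    eq_of_exp_eq_one (isPreconnected_range (b.arc j).continuous) Ψ.continuous.continuousOn hΨj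
      hz' hhi
  have := hjump (b.coangle j z) (fun r hr => ⟨(hcm r hr).1.le, (hbelow r hr).le⟩)
    (fun x hx hxr => by
      have hx' : b.coangle j (Circle.exp x) = x :=
        b.coangle_exp j ⟨hx.1, hx.2.trans hzm.2.le⟩
      refine hΨ _ (fun r hr he => hxr r hr (by rw [← he, hx'])) fun r hr he => ?_
      have := habove r (Ioo_subset_Icc_self hr)
      rw [← he, hx'] at this
      exact absurd hx.2 this.not_ge)
  simpa [hz'e, hδ] using this

end BoundaryArcs

/-! ### The winding of paths in the circle -/

/-- A continuous choice of the angle along the path `γ` changes by `ω`. -/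
def HasWinding {x y : Circle} (γ : Path x y) (ω : ℝ) : Prop :=
  ∃ l : C(unitInterval, ℝ), (∀ r, Circle.exp (l r) = γ r) ∧ l 1 - l 0 = ω

theorem exists_hasWinding {x y : Circle} (γ : Path x y) : ∃ ω, HasWinding γ ω := by
  obtain ⟨l, hl⟩ := exists_lift_path γ.toContinuousMap
  exact ⟨_, l, hl, rfl⟩

theorem HasWinding.eq_of_homotopic {x y : Circle} {γ γ' : Path x y} {ω ω' : ℝ}
    (h : HasWinding γ ω) (h' : HasWinding γ' ω') (hh : γ.Homotopic γ') : ω = ω' := by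
  obtain ⟨l, hl, rfl⟩ := h
  obtain ⟨l', hl', rfl⟩ := h'
  obtain ⟨H⟩ := hh
  obtain ⟨φ, hφ, hφ0⟩ := exists_lift_homotopy (H : C(unitInterval × unitInterval, Circle)) l
    (fun y => by simp [hl])
  have hend : ∀ e : unitInterval, (∀ t t', H (t, e) = H (t', e)) → φ (1, e) = l e := by
    intro e he
    rw [← hφ0]
    exact Circle.isCoveringMap_exp.const_of_comp (g := fun t => φ (t, e)) (by fun_prop)
      (fun t t' => by simpa [hφ] using he t t') 1 0
  have hlift := eq_of_exp_eq_one (S := univ) isPreconnected_univ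
    (f := fun r : unitInterval => φ (1, r) - l' r) (by fun_prop)
    (fun r _ => by simp [hφ, hl']) (mem_univ 1) (mem_univ 0)
  rw [hend 1 (by simp), hend 0 (by simp)] at hlift
  linarith

theorem HasWinding.trans {x y z : Circle} {γ : Path x y} {γ' : Path y z} {ω ω' : ℝ}
    (h : HasWinding γ ω) (h' : HasWinding γ' ω') : HasWinding (γ.trans γ') (ω + ω') := by
  obtain ⟨l, hl, rfl⟩ := h
  obtain ⟨l', hl', rfl⟩ := h'
  let p : Path (l 0) (l 1) := ⟨l, rfl, rfl⟩
  let p' : Path (l 1) (l 1 + (l' 1 - l' 0)) :=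
    ⟨⟨fun r => l 1 + (l' r - l' 0), by fun_prop⟩, by simp, by simp⟩
  refine ⟨(p.trans p').toContinuousMap, fun r => ?_, ?_⟩
  · change Circle.exp ((p.trans p') r) = _
    rw [Path.trans_apply, Path.trans_apply]
    split_ifs with hr
    · exact hl _
    · change Circle.exp (l 1 + (l' _ - l' 0)) = _
      simp [Circle.exp_add, hl, hl']
  · change (p.trans p') 1 - (p.trans p') 0 = _
    simp
    ring

/-! ### The invariants of sweeps and of Dehn twists -/

theorem IsCoreCurve.hasWinding {β : C(Circle, BaseAnnulus)} (h : IsCoreCurve β) (z₀ : Circle) :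
    ∃ ω : ℝ, (ω = 2 * π ∨ ω = -(2 * π)) ∧
      HasWinding ((basedLoop β z₀).map continuous_fst) ω := by
  have key : ∀ (p : ℤ) (u : C(Circle, Circle)), (∀ z, u z = z ^ p) →
      β.Homotopic (coreCircle u) →
      HasWinding ((basedLoop β z₀).map continuous_fst) (p * (2 * π)) := by
    intro p u hu hh
    obtain ⟨φ, hφ⟩ := exists_angle_of_homotopic
      ((ContinuousMap.Homotopic.refl (ContinuousMap.fst : C(BaseAnnulus, Circle))).comp hh.symm)
    refine ⟨⟨fun r => p * (Complex.arg (z₀ : ℂ) + 2 * π * r) + φ (z₀ * Circle.exp (2 * π * r)),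
      by fun_prop⟩, fun r => ?_, ?_⟩
    · have := hφ (z₀ * Circle.exp (2 * π * r))
      change Circle.exp (p * (Complex.arg (z₀ : ℂ) + 2 * π * r) +
        φ (z₀ * Circle.exp (2 * π * r))) = (β (z₀ * Circle.exp (2 * π * r))).1
      change (β (z₀ * Circle.exp (2 * π * r))).1 = u _ * _ at this
      rw [this, hu, Circle.exp_add, Circle.exp_intCast_mul, Circle.exp_add,
        Circle.exp_arg]
    · simp
      ring
  rcases h.2.2 with hh | hh
  · exact ⟨_, Or.inl rfl, by simpa using key 1 (ContinuousMap.id Circle) (by simp) hh⟩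
  · exact ⟨_, Or.inr rfl, by simpa using key (-1) ⟨fun z => z⁻¹, continuous_inv⟩ (by simp) hh⟩

namespace BoundaryArcs

variable {n : ℕ} {b : BoundaryArcs n}

/-- A map of the pair that fixes `b × S¹` pointwise restricts to a homeomorphism isotopic to the
identity. -/
theorem restrictsToIsotopicId_of_fixing {X : Type*} [TopologicalSpace X] {A : Set X} {f : C(X, X)}
    (h : ∀ x ∈ A, f x = x) : RestrictsToIsotopicId A f :=
  ⟨⟨fun v => v.2, by fun_prop⟩, fun _ => (Homeomorph.refl _).isHomeomorph, fun _ => rfl,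
    fun a => (h a a.2).symm⟩

namespace IsRegularNhd

variable {γ : C(unitInterval, BaseAnnulus)} {ν : C(unitInterval × ℝ, BaseAnnulus)}

/-- The ends of a regular neighbourhood lie in a single boundary component of `B`. -/
theorem end_level (hν : b.IsRegularNhd γ ν) {e : unitInterval} (he : e = 0 ∨ e = 1) {r : ℝ}
    (hr : r ∈ Icc (-1 : ℝ) 1) : (ν (e, r)).2 = (γ e).2 := by
  rw [← hν.core]
  have hfin : ({0, 1} : Set unitInterval).Finite := Set.toFinite _
  exact isPreconnected_Icc.constant_of_mapsTo (T := ({0, 1} : Set unitInterval))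
    (f := fun r : ℝ => (ν (e, r)).2) hfin.isDiscrete (by fun_prop)
    (fun s hs => (hν.mem_bdry_iff e s hs).2 he) hr
    (show (0 : ℝ) ∈ Icc (-1 : ℝ) 1 by norm_num)

/-- The end `r ↦ ν (e, r)` of a regular neighbourhood on `∂₁B` avoids `b`. -/
theorem end_notMem (hν : b.IsRegularNhd γ ν) {e : unitInterval} (he : e = 0 ∨ e = 1)
    (hγ : (γ e).2 = 1) {r : ℝ} (hr : r ∈ Icc (-1 : ℝ) 1) : (ν (e, r)).1 ∉ b.union :=
  fun h => hν.avoids e r hr ⟨(hν.end_level he hr).trans hγ, h⟩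

theorem end_injOn (hν : b.IsRegularNhd γ ν) {e : unitInterval} (he : e = 0 ∨ e = 1) :
    InjOn (fun r : ℝ => (ν (e, r)).1) (Icc (-1) 1) := by
  intro r hr s hs h
  have := hν.injOn (mk_mem_prod (mem_univ e) hr) (mk_mem_prod (mem_univ e) hs)
    (Prod.ext h ((hν.end_level he hr).trans (hν.end_level he hs).symm))
  exact (Prod.mk.inj this).2

/-- The sides of a regular neighbourhood do not belong to its open part. -/
theorem side_notMem (hν : b.IsRegularNhd γ ν) (s : unitInterval) {r : ℝ} (hr : r = -1 ∨ r = 1) :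
    ν (s, r) ∉ ν '' (Set.univ ×ˢ Set.Ioo (-1 : ℝ) 1) := by
  rintro ⟨⟨s', r'⟩, ⟨-, hr'⟩, h⟩
  have hmem : r ∈ Icc (-1 : ℝ) 1 := by rcases hr with rfl | rfl <;> norm_num
  have := hν.injOn (mk_mem_prod (mem_univ s') (Ioo_subset_Icc_self hr'))
    (mk_mem_prod (mem_univ s) hmem) h
  obtain ⟨-, rfl⟩ := Prod.mk.inj this
  rcases hr with rfl | rfl <;> simp at hr'

end IsRegularNhd

/-- A sweep fixes `b` pointwise. -/
theorem IsSweep.eq_of_mem_carrier {γ : C(unitInterval, BaseAnnulus)} {s₀ : unitInterval}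
    {β : Path (γ s₀) (γ s₀)} {h : C(BaseAnnulus, BaseAnnulus)} (hs : b.IsSweep γ s₀ β h)
    {x : BaseAnnulus} (hx : x ∈ b.carrier) : h x = x := by
  obtain ⟨ν, hν, hfix, -⟩ := hs
  refine hfix x ?_
  rintro ⟨⟨s, r⟩, ⟨-, hr⟩, rfl⟩
  exact hν.avoids s r (Ioo_subset_Icc_self hr) hx

/-- A sweep along a core curve around `bⱼ` displaces `bⱼ` by one turn relative to all other arcs,
and it has degree one on the base. The degree is read off on `∂₀B`, which the sweep fixes; in
particular the angular displacement `θ` is single-valued on `∂₁B`. Across each of the two ends of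
the regular neighbourhood it changes by the winding of `β`, since the sides are fixed. -/
theorem IsSweep.exists_hasInvariants {j : Fin n}
    {γ : C(unitInterval, BaseAnnulus)}
    (hγ : b.IsArcAround j γ) {s₀ : unitInterval} {β : Path (γ s₀) (γ s₀)} {ω : ℝ}
    (hω : ω = 2 * π ∨ ω = -(2 * π)) (hβ : HasWinding (β.map continuous_fst) ω)
    {h : C(BaseAnnulus, BaseAnnulus)} (hs : b.IsSweep γ s₀ β h) :
    ∃ σ : ℤ, σ * σ = 1 ∧ b.HasInvariants (h.prodMap (ContinuousMap.id Circle)) 1 0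
      (fun i => if i = j then σ else 0) := by
  have hfixb := fun x => hs.eq_of_mem_carrier (x := x)
  obtain ⟨ν, hν, hfix, t₁, t₂, ht, ht₁, ht₂, hht, hhom⟩ := hs
  obtain ⟨p, q, θ, hθ⟩ := exists_angle_form ⟨fun x => (h x.1).1, by fun_prop⟩
  simp only [ContinuousMap.coe_mk] at hθ
  have hγ2 : ∀ e : unitInterval, e = 0 ∨ e = 1 → (γ e).2 = 1 := by
    rintro e (rfl | rfl)
    exacts [hγ.start_mem.1, hγ.end_mem.1]
  have hbd : ∀ s : unitInterval, ∀ r ∈ Icc (-1 : ℝ) 1, (ν (s, r)).2 = 0 ∨ (ν (s, r)).2 = 1 →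
      (s = 0 ∨ s = 1) ∧ (ν (s, r)).2 = 1 := by
    intro s r hr h
    have hs := (hν.mem_bdry_iff s r hr).1 h
    exact ⟨hs, (hν.end_level hs hr).trans (hγ2 s hs)⟩
  -- The boundary component `∂₀B` is fixed.
  have hfix0 : ∀ z : Circle, h (z, 0) = (z, 0) := by
    intro z
    refine hfix _ ?_
    rintro ⟨⟨s, r⟩, ⟨-, hr⟩, hsr⟩
    have := (hbd s r (Ioo_subset_Icc_self hr) (Or.inl (by rw [hsr]))).2
    rw [hsr] at this
    exact zero_ne_one this
  obtain ⟨rfl, rfl⟩ : p = 1 ∧ q = 0 := by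
    have := angle_form_unique (p := p) (q := q) (p' := 1) (q' := 0)
      (θ := θ.comp ⟨fun x => ((x.1.1, 0), x.2), by fun_prop⟩) (θ' := 0) (fun x => by
        have := hθ ((x.1.1, 0), x.2)
        rw [hfix0] at this
        simpa using this.symm)
    exact ⟨this.1, this.2.1⟩
  simp only [zpow_one, zpow_zero, mul_one] at hθ
  have hθ1 : ∀ x : BaseAnnulus, h x = x → Circle.exp (θ (x, 1)) = 1 := by
    intro x hx
    have := hθ (x, 1)
    rw [hx] at this
    simpa using this
  -- The change of `θ` across the neighbourhood does not depend on the position along `γ`.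
  have hside : ∀ s s' : unitInterval, ∀ r : ℝ, r = -1 ∨ r = 1 →
      θ (ν (s, r), 1) = θ (ν (s', r), 1) := fun s s' r hr =>
    eq_of_exp_eq_one (S := univ) isPreconnected_univ
      (f := fun s : unitInterval => θ (ν (s, r), 1)) (by fun_prop)
      (fun s _ => hθ1 _ (hfix _ (hν.side_notMem s hr))) (mem_univ s) (mem_univ s')
  -- On the transversal through the point of `β` it is the winding of `β`.
  have hjump0 : θ (ν (s₀, 1), 1) - θ (ν (s₀, -1), 1) = ω := by
    obtain ⟨ω₁, h₁⟩ := exists_hasWinding (t₁.map continuous_fst)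
    obtain ⟨ω₂, h₂⟩ := exists_hasWinding (t₂.map continuous_fst)
    have h₁₂ : HasWinding ((t₁.trans t₂).map continuous_fst) (ω₁ + ω₂) := by
      rw [Path.map_trans]; exact h₁.trans h₂
    have hright : HasWinding (((t₁.trans β).trans t₂).map continuous_fst) (ω₁ + ω + ω₂) := by
      rw [Path.map_trans, Path.map_trans]; exact (h₁.trans hβ).trans h₂
    have hleft : HasWinding (ht.map continuous_fst)
        (ω₁ + ω₂ + (θ (ν (s₀, 1), 1) - θ (ν (s₀, -1), 1))) := by
      obtain ⟨l, hl, hl'⟩ := h₁₂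
      refine ⟨⟨fun r => l r + θ ((t₁.trans t₂) r, 1), by fun_prop⟩, fun r => ?_, ?_⟩
      · have e1 : (ht.map continuous_fst) r = (ht r).1 := rfl
        have e2 := hl r
        have e3 : ((t₁.trans t₂).map continuous_fst) r = ((t₁.trans t₂) r).1 := rfl
        have e4 := hθ ((t₁.trans t₂) r, 1)
        rw [e1, hht]
        change Circle.exp (l r + θ ((t₁.trans t₂) r, 1)) = _
        rw [Circle.exp_add, e2, e3]
        exact e4.symm
      · rw [← hl']
        simp
        ring
    have := hleft.eq_of_homotopic hright (hhom.map ⟨Prod.fst, continuous_fst⟩)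
    linarith
  have hjump : ∀ e : unitInterval, θ (ν (e, 1), 1) - θ (ν (e, -1), 1) = ω := fun e => by
    rw [hside e s₀ 1 (Or.inr rfl), hside e s₀ (-1) (Or.inl rfl), hjump0]
  let Ψ : C(Circle, ℝ) := ⟨fun z => θ ((z, 1), 1), by fun_prop⟩
  have hΨν : ∀ e : unitInterval, e = 0 ∨ e = 1 → ∀ r ∈ Icc (-1 : ℝ) 1,
      Ψ (ν (e, r)).1 = θ (ν (e, r), 1) := by
    intro e he r hr
    have : ((ν (e, r)).1, (1 : unitInterval)) = ν (e, r) :=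
      Prod.ext rfl ((hν.end_level he hr).trans (hγ2 e he)).symm
    simp only [Ψ, ContinuousMap.coe_mk, this]
  have hm : (-1 : ℝ) ∈ Icc (-1 : ℝ) 1 := by norm_num
  have hp : (1 : ℝ) ∈ Icc (-1 : ℝ) 1 := by norm_num
  have h0 : (0 : unitInterval) = 0 ∨ (0 : unitInterval) = 1 := Or.inl rfl
  have h1 : (1 : unitInterval) = 0 ∨ (1 : unitInterval) = 1 := Or.inr rfl
  obtain ⟨κ, hκ, hsign⟩ := b.exists_sign_of_jump (j := j) (Ψ := Ψ) (c := fun r => (ν (0, r)).1)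
    (c' := fun r => (ν (1, r)).1) (δ := ω) (by fun_prop) (by fun_prop) (hν.end_injOn h0)
    (hν.end_injOn h1) (fun r hr => hν.end_notMem h0 (hγ2 _ h0) hr)
    (fun r hr => hν.end_notMem h1 (hγ2 _ h1) hr)
    (by simpa only [hν.core] using hγ.start_adjacent)
    (by simpa only [hν.core] using hγ.end_adjacent)
    (by simpa only [hν.core] using hγ.gap_ne)
    (fun z hz hz' => hθ1 _ (hfix _ (by
      rintro ⟨⟨s, r⟩, ⟨-, hr⟩, hsr⟩
      rcases (hbd s r (Ioo_subset_Icc_self hr) (Or.inr (by rw [hsr]))).1 with rfl | rfl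
      · exact hz r hr (by rw [hsr])
      · exact hz' r hr (by rw [hsr]))))
    (by rw [hΨν 0 h0 1 hp, hΨν 0 h0 (-1) hm, hjump])
    (by rw [hΨν 1 h1 1 hp, hΨν 1 h1 (-1) hm, hjump])
  -- On each annulus `bᵢ × S¹` the displacement is a constant in `2πℤ`.
  have hθfix : ∀ i, ∀ x ∈ b.piece i, Circle.exp (θ x) = 1 := by
    intro i x hx
    have := hθ x
    rw [hfixb x.1 (b.piece_subset i hx)] at this
    simpa using this
  have hconst : ∀ i, ∃ u : ℤ, ∀ x ∈ b.piece i, θ x = 2 * π * u := by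
    intro i
    obtain ⟨u, hu⟩ := Circle.exp_eq_one.1 (hθfix i _ (b.arc_mem_piece i 0 1))
    refine ⟨u, fun x hx => ?_⟩
    rw [eq_of_exp_eq_one (b.isPreconnected_piece i) θ.continuous.continuousOn (hθfix i) hx
      (b.arc_mem_piece i 0 1), hu]
    ring
  choose u hu using hconst
  have hinv : b.HasInvariants (h.prodMap (ContinuousMap.id Circle)) 1 0 u := by
    refine ⟨θ, 0, fun x => ?_, fun x => ?_, fun i x hx => ?_⟩
    · simpa using hθ x
    · simp
    · have hxx : (h.prodMap (ContinuousMap.id Circle)) x = x :=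
        Prod.ext (hfixb x.1 (b.piece_subset i hx)) rfl
      rw [hxx]
      exact ⟨hx, by simp [hu i x hx]⟩
  obtain ⟨σ, hσ, hdiff⟩ : ∃ σ : ℤ, σ * σ = 1 ∧ ∀ i, i ≠ j → u i = u j - σ := by
    have hval : ∃ σ : ℤ, σ * σ = 1 ∧ κ * ω = -(2 * π * σ) := by
      rcases hκ with rfl | rfl <;> rcases hω with rfl | rfl
      · exact ⟨-1, by norm_num, by push_cast; ring⟩
      · exact ⟨1, by norm_num, by push_cast; ring⟩
      · exact ⟨1, by norm_num, by push_cast; ring⟩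
      · exact ⟨-1, by norm_num, by push_cast; ring⟩
    obtain ⟨σ, hσ, hκω⟩ := hval
    refine ⟨σ, hσ, fun i hij => ?_⟩
    have := hsign i hij (b.arc i 0) ⟨0, rfl⟩ (b.arc j 0) ⟨0, rfl⟩
    have ei : Ψ (b.arc i 0) = 2 * π * u i := hu i _ (b.arc_mem_piece i 0 1)
    have ej : Ψ (b.arc j 0) = 2 * π * u j := hu j _ (b.arc_mem_piece j 0 1)
    rw [ei, ej, hκω] at this
    have : (2 * π) * (u i : ℝ) = (2 * π) * (u j - σ) := by linarith
    exact_mod_cast mul_left_cancel₀ two_pi_pos.ne' this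
  refine ⟨σ, hσ, ?_⟩
  have := hinv.add_const (-(u j - σ))
  convert this using 2 with i
  by_cases hij : i = j
  · subst hij; simp
  · simp [hij, hdiff i hij]

/-- A Dehn twist about a vertical essential annulus is the identity on the base and fixes each
`bⱼ × S¹`; the loop `∂₁B` crosses the annulus once, so that its image winds once around the
fibre. -/
theorem _root_.IsVerticalDehnTwist.exists_hasInvariants [NeZero n]
    {a : C(unitInterval, BaseAnnulus)} {D : C(BaseAnnulus × Circle, BaseAnnulus × Circle)}
    (hD : IsVerticalDehnTwist b a D) :
    (∀ x ∈ b.thick, D x = x) ∧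
      ∃ σ : ℤ, σ * σ = 1 ∧ b.HasInvariants D 1 σ (fun _ => 0) := by
  obtain ⟨h0, h1, ν, hν, hfix, htw⟩ := hD
  have hbase : ∀ x, (D x).1 = x.1 := by
    rintro ⟨x, w⟩
    by_cases hx : x ∈ ν '' (Set.univ ×ˢ Set.Icc (-1 : ℝ) 1)
    · obtain ⟨⟨s, r⟩, ⟨-, hr⟩, rfl⟩ := hx
      rw [htw s r hr w]
    · rw [hfix x hx w]
  have hthick : ∀ x ∈ b.thick, D x = x := by
    rintro ⟨x, w⟩ hx
    refine hfix x ?_ w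
    rintro ⟨⟨s, r⟩, ⟨-, hr⟩, rfl⟩
    exact hν.avoids s r hr hx
  refine ⟨hthick, ?_⟩
  obtain ⟨k, q, ψ, hψ⟩ := exists_angle_form ⟨fun x => (D x).2, by fun_prop⟩
  simp only [ContinuousMap.coe_mk] at hψ
  let j : Fin n := 0
  obtain rfl : q = 1 := by
    let z := b.arc j 0
    refine circle_form_unique (θ := ⟨fun w => k * b.angle j z + ψ ((z, 1), w), by fun_prop⟩)
      (θ' := 0) fun w => ?_
    have := hψ ((z, 1), w)
    rw [hthick _ (b.piece_subset j (b.arc_mem_piece j 0 w))] at this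
    simp only [ContinuousMap.coe_mk, exp_angle, Circle.exp_add, Circle.exp_intCast_mul,
      ContinuousMap.zero_apply, Circle.exp_zero, mul_one, zpow_one]
    refine Eq.trans ?_ this.symm
    simp only
    ac_rfl
  have hinv : b.HasInvariants D 1 k (fun _ => 0) := by
    refine ⟨0, ψ, fun x => by simp [hbase], fun x => by simp [hψ], fun i x hx => ?_⟩
    rw [hthick x (b.piece_subset i hx)]
    exact ⟨hx, by simp⟩
  refine ⟨k, ?_, hinv⟩
  -- The angle in the fibre along `∂₁B`.
  let Ψ : ℝ → ℝ := fun x => k * x + ψ ((Circle.exp x, 1), 1)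
  have hΨc : Continuous Ψ := by fun_prop
  have hΨ : ∀ x, Circle.exp (Ψ x) = (D ((Circle.exp x, 1), 1)).2 := by
    intro x
    rw [hψ]
    simp [Ψ, Circle.exp_add]
  have hm : (-1 : ℝ) ∈ Icc (-1 : ℝ) 1 := by norm_num
  have hp : (1 : ℝ) ∈ Icc (-1 : ℝ) 1 := by norm_num
  have he : (1 : unitInterval) = 0 ∨ (1 : unitInterval) = 1 := Or.inr rfl
  have hνeq : ∀ r ∈ Icc (-1 : ℝ) 1, ((ν (1, r)).1, (1 : unitInterval)) = ν (1, r) := fun r hr =>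
    Prod.ext rfl ((hν.end_level he hr).trans h1).symm
  have hnot : ∀ r ∈ Icc (-1 : ℝ) 1, (ν (1, r)).1 ∉ range (b.arc j) := fun r hr h =>
    hν.end_notMem he h1 hr (b.range_arc_subset j h)
  let ρ : ℝ → ℝ := fun r => b.coangle j (ν (1, r)).1
  have hρexp : ∀ r, Circle.exp (ρ r) = (ν (1, r)).1 := fun r => b.exp_coangle j _
  have hρc : ContinuousOn ρ (Icc (-1) 1) :=
    (b.continuousOn_coangle j).comp (f := fun r : ℝ => (ν (1, r)).1) (by fun_prop) hnot
  have hΨρ : ∀ r ∈ Icc (-1 : ℝ) 1, Circle.exp (Ψ (ρ r)) = Circle.exp (π * (r + 1)) := by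
    intro r hr
    rw [hΨ, hρexp, hνeq r hr, htw 1 r hr, mul_one]
  have hchange : Ψ (ρ 1) - Ψ (ρ (-1)) = 2 * π := by
    have := eq_of_exp_eq_one (S := Icc (-1 : ℝ) 1) isPreconnected_Icc
      (f := fun r => Ψ (ρ r) - π * (r + 1)) ((hΨc.comp_continuousOn hρc).sub (by fun_prop))
      (fun r hr => by rw [Circle.exp_sub, hΨρ r hr, div_self']) hp hm
    linarith
  obtain ⟨κ, hκ, hjump⟩ := jump_across (Ψ := Ψ) (ρ := ρ) (A := b.hi j) hΨc hρc
    (fun r hr s hs h => hν.end_injOn he hr hs (by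
      simp only [← hρexp]; exact congrArg _ h))
  have hjump' := hjump (b.lo j + 2 * π)
    (fun r hr => Ioo_subset_Icc_self (b.coangle_mem j (hnot r hr)))
    (fun x hx hxr => by
      rw [hΨ]
      by_cases hN : ((Circle.exp x, 1) : BaseAnnulus) ∈ ν '' (Set.univ ×ˢ Set.Icc (-1 : ℝ) 1)
      · obtain ⟨⟨s, r⟩, ⟨-, hr⟩, hsr⟩ := hN
        have hs : s = 0 ∨ s = 1 := (hν.mem_bdry_iff s r hr).1 (by rw [hsr]; exact Or.inr rfl)
        have hs1 : s = 1 := by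
          refine hs.resolve_left ?_
          rintro rfl
          have := (hν.end_level hs hr).trans h0
          rw [hsr] at this
          exact one_ne_zero this
        subst hs1
        have hxρ : x = ρ r := by
          simp only [ρ, hsr, b.coangle_exp j hx]
        have hrb : r = -1 ∨ r = 1 := by
          by_contra! hne
          exact hxr r ⟨lt_of_le_of_ne hr.1 hne.1.symm, lt_of_le_of_ne hr.2 hne.2⟩ hxρ
        rw [← hΨ, hxρ, hΨρ r hr]
        rcases hrb with rfl | rfl
        · simp
        · rw [show π * (1 + 1) = 2 * π by ring, Circle.exp_two_pi]
      · rw [hfix _ hN])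
  -- Over `bⱼ` nothing changes, so the total change is `2πk`.
  have hbj : Ψ (b.lo j) = Ψ (b.hi j) :=
    eq_of_exp_eq_one (S := Icc (b.lo j) (b.hi j)) isPreconnected_Icc hΨc.continuousOn
      (fun x hx => by
        rw [hΨ, hthick _ (b.piece_subset j ⟨rfl, b.exp_mem_range_arc j hx⟩)])
      ⟨le_rfl, (b.lo_lt_hi j).le⟩ ⟨(b.lo_lt_hi j).le, le_rfl⟩
  have hturn : Ψ (b.lo j + 2 * π) = Ψ (b.lo j) + 2 * π * k := by
    simp only [Ψ, Circle.exp_add_two_pi]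
    ring
  rw [hturn, hbj, hchange] at hjump'
  have : (2 * π) * (k : ℝ) = (2 * π) * κ := by linarith
  have hk := mul_left_cancel₀ two_pi_pos.ne' this
  have : (k : ℝ) * k = 1 := by rcases hκ with rfl | rfl <;> rw [hk] <;> norm_num
  exact_mod_cast this

end BoundaryArcs

/-! ### Existence of sweeps and of Dehn twists -/

theorem continuous_abs_angleAt_sub (c : ℝ) : Continuous fun z => |angleAt c z - c| := by
  have h : (fun z => |angleAt c z - c|) =
      fun z : Circle => Real.arccos ((z * Circle.exp (-c) : Circle) : ℂ).re := by
    funext z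
    set w : Circle := z * Circle.exp (-c) with hw
    have e : angleAt c z - c = Complex.arg (w : ℂ) := by rw [angleAt, hw]; ring
    have hcos := Complex.cos_arg (Circle.coe_ne_zero w)
    rw [Circle.norm_coe, div_one] at hcos
    rw [e, ← hcos, ← Real.cos_abs, Real.arccos_cos (abs_nonneg _) (Complex.abs_arg_le_pi _)]
  rw [h]
  exact Real.continuous_arccos.comp (Complex.continuous_re.comp (by fun_prop))

/-- Paths in the annulus with the same endpoints and the same winding are homotopic. -/
theorem homotopic_of_hasWinding {x y : BaseAnnulus} {γ γ' : Path x y} {ω : ℝ}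
    (h : HasWinding (γ.map continuous_fst) ω) (h' : HasWinding (γ'.map continuous_fst) ω) :
    γ.Homotopic γ' := by
  obtain ⟨l, hl, hω⟩ := h
  obtain ⟨l', hl', hω'⟩ := h'
  have e : ∀ r, Circle.exp (l r) = (γ r).1 := hl
  have e' : ∀ r, Circle.exp (l' r) = (γ' r).1 := hl'
  obtain ⟨c, hc⟩ := exists_int_of_exp_eq (x := l 0) (y := l' 0) (by rw [e, e']; simp)
  have hlin : ∀ (t r s : unitInterval), (unitInterval.symm t : ℝ) * r + t * s ∈ unitInterval :=
    fun t r s => ⟨by have := t.2.1; have := r.2.1; have := s.2.1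
                     have := (unitInterval.symm t).2.1; positivity, by
      have ht := t.2; have hr := r.2; have hs := s.2
      rw [unitInterval.coe_symm_eq]
      nlinarith [ht.1, ht.2, hr.2, hs.2]⟩
  refine ⟨{ toFun := fun v => (Circle.exp (l v.2 + v.1 * (l' v.2 + 2 * π * c - l v.2)),
              ⟨_, hlin v.1 (γ v.2).2 (γ' v.2).2⟩)
            continuous_toFun := by fun_prop
            map_zero_left := fun r => ?_
            map_one_left := fun r => ?_
            prop' := ?_ }⟩
  · refine Prod.ext ?_ (Subtype.ext ?_) <;> simp [e]
  · refine Prod.ext ?_ (Subtype.ext ?_) <;> simp [e', Circle.exp_add, Circle.exp_two_pi_mul_int]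
  · rintro t r (rfl | rfl)
    · have : l' 0 + 2 * π * c - l 0 = 0 := by rw [hc]; ring
      refine Prod.ext ?_ (Subtype.ext ?_)
      · simp [this, e]
      · simp
        ring
    · have : l' 1 + 2 * π * c - l 1 = 0 := by linarith
      refine Prod.ext ?_ (Subtype.ext ?_)
      · simp [this, e]
      · simp
        ring

/-- The strip `|ρ - 1| ≤ η` in the annulus, where `ρ` is the function `vHeight c A` below, whose
level sets `ρ = const` are V-shaped arcs with both ends on `∂₁B`, symmetric about the angle `c`. It
is parametrized in such a way that `ρ = 1 + η r` at the point with parameters `(s, r)`. The clamping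
of the second coordinate to `[0,1]` is inactive for `|r| ≤ 1`. -/
noncomputable def vStrip (c A η : ℝ) : C(unitInterval × ℝ, BaseAnnulus) :=
  ⟨fun v => (Circle.exp (c + A * (2 * v.1 - 1) * (1 + η * v.2)),
    projIcc 0 1 zero_le_one (1 - (1 - |2 * (v.1 : ℝ) - 1|) * (1 + η * v.2) / 2)), by
      have := continuous_projIcc (h := (zero_le_one : (0 : ℝ) ≤ 1))
      fun_prop⟩

/-- The function `(z, v) ↦ |arg z - c| / A + 2 (1 - v)` on the annulus. -/
noncomputable def vHeight (c A : ℝ) : C(BaseAnnulus, ℝ) :=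
  ⟨fun p => |angleAt c p.1 - c| / A + 2 * (1 - p.2),
    (((continuous_abs_angleAt_sub c).comp continuous_fst).div_const A).add (by fun_prop)⟩

section VStrip

variable {c A η : ℝ}

theorem abs_fold_le (s : unitInterval) : |2 * (s : ℝ) - 1| ≤ 1 :=
  abs_le.2 ⟨by linarith [s.2.1], by linarith [s.2.2]⟩

theorem abs_fold_eq_one {s : unitInterval} : |2 * (s : ℝ) - 1| = 1 ↔ s = 0 ∨ s = 1 := by
  rw [abs_eq zero_le_one, or_comm, Subtype.ext_iff, Subtype.ext_iff]
  simp only [Icc.coe_zero, Icc.coe_one]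
  constructor <;> rintro (h | h)
  · left; linarith
  · right; linarith
  · left; linarith
  · right; linarith

theorem height_bounds (hη0 : 0 < η) (hη1 : η < 1 / 2) {r : ℝ} (hr : r ∈ Icc (-1 : ℝ) 1) :
    1 / 2 < 1 + η * r ∧ 1 - η ≤ 1 + η * r ∧ 1 + η * r ≤ 1 + η :=
  ⟨by nlinarith [hr.1], by nlinarith [hr.1], by nlinarith [hr.2]⟩

theorem vStrip_fst (c A η : ℝ) (s : unitInterval) (r : ℝ) :
    (vStrip c A η (s, r)).1 = Circle.exp (c + A * (2 * s - 1) * (1 + η * r)) := rfl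

theorem vStrip_snd (hη0 : 0 < η) (hη1 : η < 1 / 2) (s : unitInterval) {r : ℝ}
    (hr : r ∈ Icc (-1 : ℝ) 1) :
    ((vStrip c A η (s, r)).2 : ℝ) = 1 - (1 - |2 * (s : ℝ) - 1|) * (1 + η * r) / 2 := by
  obtain ⟨h1, -, h3⟩ := height_bounds hη0 hη1 hr
  have h4 := abs_fold_le s
  have h5 := abs_nonneg (2 * (s : ℝ) - 1)
  have : 1 - (1 - |2 * (s : ℝ) - 1|) * (1 + η * r) / 2 ∈ Icc (0 : ℝ) 1 :=
    ⟨by nlinarith, by nlinarith⟩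
  simp only [vStrip, ContinuousMap.coe_mk, projIcc_of_mem zero_le_one this]

theorem abs_vStrip_angle (hA0 : 0 < A) (hη0 : 0 < η) (hη1 : η < 1 / 2) (s : unitInterval) {r : ℝ}
    (hr : r ∈ Icc (-1 : ℝ) 1) :
    |A * (2 * s - 1) * (1 + η * r)| = A * |2 * (s : ℝ) - 1| * (1 + η * r) := by
  obtain ⟨h1, -, -⟩ := height_bounds hη0 hη1 hr
  rw [abs_mul, abs_mul, abs_of_pos hA0, abs_of_pos (by linarith : 0 < 1 + η * r)]

theorem angleAt_vStrip (hA0 : 0 < A) (hη0 : 0 < η) (hη1 : η < 1 / 2) (hAπ : A * (1 + η) < π)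
    (s : unitInterval) {r : ℝ} (hr : r ∈ Icc (-1 : ℝ) 1) :
    angleAt c (vStrip c A η (s, r)).1 = c + A * (2 * s - 1) * (1 + η * r) := by
  obtain ⟨h1, -, h3⟩ := height_bounds hη0 hη1 hr
  have h4 : |A * (2 * s - 1) * (1 + η * r)| < π := by
    rw [abs_vStrip_angle hA0 hη0 hη1 s hr]
    have := abs_fold_le s
    calc A * |2 * (s : ℝ) - 1| * (1 + η * r) ≤ A * 1 * (1 + η) := by gcongr
      _ < π := by linarith
  rw [abs_lt] at h4
  exact angleAt_exp (by linarith) (by linarith)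

theorem vHeight_vStrip (hA0 : 0 < A) (hη0 : 0 < η) (hη1 : η < 1 / 2) (hAπ : A * (1 + η) < π)
    (s : unitInterval) {r : ℝ} (hr : r ∈ Icc (-1 : ℝ) 1) :
    vHeight c A (vStrip c A η (s, r)) = 1 + η * r := by
  simp only [vHeight, ContinuousMap.coe_mk]
  rw [angleAt_vStrip hA0 hη0 hη1 hAπ s hr, vStrip_snd hη0 hη1 s hr, add_sub_cancel_left,
    abs_vStrip_angle hA0 hη0 hη1 s hr]
  field_simp
  ring

theorem vStrip_mem_bdry_iff (hη0 : 0 < η) (hη1 : η < 1 / 2) (s : unitInterval) {r : ℝ}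
    (hr : r ∈ Icc (-1 : ℝ) 1) : vStrip c A η (s, r) ∈ BaseAnnulus.bdry ↔ s = 0 ∨ s = 1 := by
  obtain ⟨h1, -, h3⟩ := height_bounds hη0 hη1 hr
  have h2 := vStrip_snd (c := c) (A := A) hη0 hη1 s hr
  have h4 := abs_fold_le s
  have h5 := abs_nonneg (2 * (s : ℝ) - 1)
  rw [← abs_fold_eq_one]
  constructor
  · rintro (h | h)
    · rw [h, Icc.coe_zero] at h2
      nlinarith
    · rw [h, Icc.coe_one] at h2
      have : (1 - |2 * (s : ℝ) - 1|) * (1 + η * r) = 0 := by linarith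
      rcases mul_eq_zero.1 this with h | h <;> linarith
  · intro h
    right
    apply Subtype.ext
    rw [h2, h]
    simp

theorem vStrip_injOn (hA0 : 0 < A) (hη0 : 0 < η) (hη1 : η < 1 / 2) (hAπ : A * (1 + η) < π) :
    InjOn (vStrip c A η) (Set.univ ×ˢ Set.Icc (-1 : ℝ) 1) := by
  rintro ⟨s, r⟩ ⟨-, hr⟩ ⟨s', r'⟩ ⟨-, hr'⟩ h
  have e1 := congrArg (vHeight c A) h
  rw [vHeight_vStrip hA0 hη0 hη1 hAπ s hr, vHeight_vStrip hA0 hη0 hη1 hAπ s' hr'] at e1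
  obtain rfl : r = r' := mul_left_cancel₀ hη0.ne' (by linarith)
  have e2 := congrArg (fun p : BaseAnnulus => angleAt c p.1) h
  simp only [angleAt_vStrip hA0 hη0 hη1 hAπ s hr, angleAt_vStrip hA0 hη0 hη1 hAπ s' hr] at e2
  have e3 : 2 * (s : ℝ) - 1 = 2 * s' - 1 := by
    have h1 := (height_bounds hη0 hη1 hr).1
    refine mul_left_cancel₀ hA0.ne' (mul_right_cancel₀ (by linarith : 1 + η * r ≠ 0) ?_)
    linarith
  have : s = s' := Subtype.ext (by linarith)
  rw [this]

/-- The open strip is given by `|ρ - 1| < η`. -/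
theorem mem_vStrip (hA0 : 0 < A) (hη0 : 0 < η) (hη1 : η < 1 / 2) {p : BaseAnnulus}
    (h1 : 1 - η < vHeight c A p) (h2 : vHeight c A p < 1 + η) :
    p ∈ vStrip c A η '' (Set.univ ×ˢ Set.Ioo (-1 : ℝ) 1) := by
  have hval : vHeight c A p = |angleAt c p.1 - c| / A + 2 * (1 - p.2) := rfl
  generalize vHeight c A p = q at h1 h2 hval
  have hq : 0 < q := by linarith
  have hle : |angleAt c p.1 - c| / A ≤ q := by linarith [p.2.2.2]
  set t := (angleAt c p.1 - c) / (A * q) with ht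
  have htabs : |t| = |angleAt c p.1 - c| / A / q := by
    rw [ht, abs_div, abs_mul, abs_of_pos hA0, abs_of_pos hq, div_div]
  have ht1 : |t| ≤ 1 := by rw [htabs]; exact (div_le_one hq).2 hle
  have ht2 := abs_le.1 ht1
  have hr : (q - 1) / η ∈ Ioo (-1 : ℝ) 1 :=
    ⟨by rw [lt_div_iff₀ hη0]; linarith, by rw [div_lt_iff₀ hη0]; linarith⟩
  have hqe : 1 + η * ((q - 1) / η) = q := by field_simp; ring
  have hs : 2 * ((t + 1) / 2) - 1 = t := by ring
  refine ⟨(⟨(t + 1) / 2, by linarith [ht2.1], by linarith [ht2.2]⟩, (q - 1) / η),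
    ⟨mem_univ _, hr⟩, Prod.ext ?_ (Subtype.ext ?_)⟩
  · rw [vStrip_fst, hqe, hs]
    have : c + A * t * q = angleAt c p.1 := by
      rw [ht]
      field_simp
      ring
    rw [this, exp_angleAt]
  · rw [vStrip_snd hη0 hη1 _ (Ioo_subset_Icc_self hr), hqe, hs, htabs]
    have e : (1 - |angleAt c p.1 - c| / A / q) * q = q - |angleAt c p.1 - c| / A := by
      field_simp
    rw [e, hval]
    ring

/-- The angle of rotation of the sweep on the level set `ρ = t`. -/
noncomputable def sweepAngle (η t : ℝ) : ℝ :=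
  2 * π * max 0 (min 1 ((t - (1 - η)) / (2 * η)))

theorem continuous_sweepAngle (η : ℝ) : Continuous (sweepAngle η) := by
  unfold sweepAngle
  fun_prop

theorem sweepAngle_of_le (hη0 : 0 < η) {t : ℝ} (ht : t ≤ 1 - η) : sweepAngle η t = 0 := by
  have : (t - (1 - η)) / (2 * η) ≤ 0 := div_nonpos_of_nonpos_of_nonneg (by linarith) (by linarith)
  rw [sweepAngle, min_eq_right (by linarith), max_eq_left this, mul_zero]

theorem sweepAngle_of_ge (hη0 : 0 < η) {t : ℝ} (ht : 1 + η ≤ t) : sweepAngle η t = 2 * π := by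
  have : 1 ≤ (t - (1 - η)) / (2 * η) := by rw [one_le_div (by linarith)]; linarith
  rw [sweepAngle, min_eq_left this]
  norm_num

/-- The sweep of the V-shaped arc `ρ = 1` along the core circle. It rotates the level sets of `ρ` by
angles that increase from `0` to `2π` across the strip. -/
noncomputable def vSweep (c A η : ℝ) : C(BaseAnnulus, BaseAnnulus) :=
  ⟨fun p => (p.1 * Circle.exp (sweepAngle η (vHeight c A p)), p.2), by
    have := continuous_sweepAngle η
    fun_prop⟩

theorem vSweep_eq_self (hA0 : 0 < A) (hη0 : 0 < η) (hη1 : η < 1 / 2) {p : BaseAnnulus}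
    (hp : p ∉ vStrip c A η '' (Set.univ ×ˢ Set.Ioo (-1 : ℝ) 1)) : vSweep c A η p = p := by
  have hexp : Circle.exp (sweepAngle η (vHeight c A p)) = 1 := by
    by_cases h1 : vHeight c A p ≤ 1 - η
    · rw [sweepAngle_of_le hη0 h1, Circle.exp_zero]
    by_cases h2 : 1 + η ≤ vHeight c A p
    · rw [sweepAngle_of_ge hη0 h2, Circle.exp_two_pi]
    exact absurd (mem_vStrip hA0 hη0 hη1 (not_le.1 h1) (not_le.1 h2)) hp
  refine Prod.ext ?_ rfl
  change p.1 * Circle.exp (sweepAngle η (vHeight c A p)) = p.1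
  rw [hexp, mul_one]

/-- The V-shaped arc `ρ = 1`. -/
noncomputable def vArc (c A η : ℝ) : C(unitInterval, BaseAnnulus) :=
  ⟨fun s => vStrip c A η (s, 0), by fun_prop⟩

/-- The midpoint of the unit interval. -/
noncomputable def unitHalf : unitInterval := ⟨1 / 2, by norm_num, by norm_num⟩

theorem vStrip_half (c A η r : ℝ) : (vStrip c A η (unitHalf, r)).1 = Circle.exp c := by
  rw [vStrip_fst]
  simp [unitHalf]

theorem vArc_snd (hη0 : 0 < η) (hη1 : η < 1 / 2) (s : unitInterval) :
    ((vArc c A η s).2 : ℝ) = 1 - (1 - |2 * (s : ℝ) - 1|) / 2 := by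
  have := vStrip_snd (c := c) (A := A) hη0 hη1 s (r := 0) (by norm_num)
  rw [mul_zero, add_zero, mul_one] at this
  exact this

theorem vArc_half (hη0 : 0 < η) (hη1 : η < 1 / 2) :
    vArc c A η unitHalf = coreCircle (ContinuousMap.id Circle) (Circle.exp c) := by
  refine Prod.ext (vStrip_half c A η 0) (Subtype.ext ?_)
  rw [vArc_snd hη0 hη1]
  simp [coreCircle, unitHalf]
  norm_num

theorem range_vArc_inter (hη0 : 0 < η) (hη1 : η < 1 / 2) :
    range (vArc c A η) ∩ range (coreCircle (ContinuousMap.id Circle)) =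
      {coreCircle (ContinuousMap.id Circle) (Circle.exp c)} := by
  apply Subset.antisymm
  · rintro _ ⟨⟨s, rfl⟩, ⟨z, hz⟩⟩
    have e1 : ((vArc c A η s).2 : ℝ) = 1 / 2 := by rw [← hz]; rfl
    rw [vArc_snd hη0 hη1] at e1
    have e2 : 2 * (s : ℝ) - 1 = 0 := by
      rw [← abs_eq_zero]
      linarith
    have : s = unitHalf := Subtype.ext (by simp only [unitHalf]; linarith)
    rw [this]
    exact vArc_half hη0 hη1
  · rintro _ rfl
    exact ⟨⟨unitHalf, vArc_half hη0 hη1⟩, ⟨_, rfl⟩⟩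

end VStrip

namespace BoundaryArcs

variable {n : ℕ} (b : BoundaryArcs n)

/-- On both sides of `bⱼ` there is an interval of length `δ` that is disjoint from `b`. -/
theorem exists_free (j : Fin n) : ∃ δ : ℝ, 0 < δ ∧ 2 * δ < b.lo j + 2 * π - b.hi j ∧
    (∀ x ∈ Ioo (b.hi j) (b.hi j + δ), Circle.exp x ∉ b.union) ∧
    ∀ x ∈ Ioo (b.lo j - δ) (b.lo j), Circle.exp x ∉ b.union := by
  let K : Set Circle := ⋃ i ∈ {i | i ≠ j}, range (b.arc i)
  have hK : IsClosed K := (Set.toFinite _).isClosed_biUnion fun i _ => b.isClosed_range_arc i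
  have hopen : IsOpen (Circle.exp ⁻¹' K)ᶜ := (hK.preimage Circle.exp.continuous).isOpen_compl
  have hnot : ∀ x ∈ Icc (b.lo j) (b.hi j), x ∈ (Circle.exp ⁻¹' K)ᶜ := by
    intro x hx h
    simp only [K, mem_preimage, mem_iUnion, exists_prop] at h
    obtain ⟨i, hij, hi⟩ := h
    exact Set.disjoint_left.1 (b.arc_disjoint i j hij) hi (b.exp_mem_range_arc j hx)
  have hlh := b.lo_lt_hi j
  have hhl := b.hi_lt j
  obtain ⟨ε₁, h₁, hb₁⟩ := Metric.isOpen_iff.1 hopen _ (hnot (b.hi j) ⟨hlh.le, le_rfl⟩)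
  obtain ⟨ε₂, h₂, hb₂⟩ := Metric.isOpen_iff.1 hopen _ (hnot (b.lo j) ⟨le_rfl, hlh.le⟩)
  refine ⟨min (min ε₁ ε₂) ((b.lo j + 2 * π - b.hi j) / 4), lt_min (lt_min h₁ h₂) (by linarith),
    ?_, ?_, ?_⟩
  · have := min_le_right (min ε₁ ε₂) ((b.lo j + 2 * π - b.hi j) / 4)
    linarith
  all_goals
    have m1 := min_le_right (min ε₁ ε₂) ((b.lo j + 2 * π - b.hi j) / 4)
    have m2 := min_le_left (min ε₁ ε₂) ((b.lo j + 2 * π - b.hi j) / 4)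
    have m3 := min_le_left ε₁ ε₂
    have m4 := min_le_right ε₁ ε₂
    intro x hx h
    obtain ⟨i, hi⟩ := mem_iUnion.1 h
    by_cases hij : i = j
  · subst hij
    exact b.exp_notMem_range_arc i ⟨hx.1, by linarith [hx.2]⟩ hi
  · refine hb₁ (a := x) ?_ ?_
    · rw [Metric.mem_ball, Real.dist_eq, abs_lt]
      constructor <;> linarith [hx.1, hx.2]
    · exact mem_iUnion₂.2 ⟨i, hij, hi⟩
  · subst hij
    refine b.exp_notMem_range_arc i (x := x + 2 * π) ⟨by linarith [hx.1], by linarith [hx.2]⟩ ?_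
    rwa [Circle.exp_add_two_pi]
  · refine hb₂ (a := x) ?_ ?_
    · rw [Metric.mem_ball, Real.dist_eq, abs_lt]
      constructor <;> linarith [hx.1, hx.2]
    · exact mem_iUnion₂.2 ⟨i, hij, hi⟩

/-- A Dehn twist about the vertical annulus over the arc at the angle `c`, supported over the
angles at distance at most `η` from `c`. -/
theorem exists_isVerticalDehnTwist [NeZero n] : ∃ a D, IsVerticalDehnTwist b a D := by
  obtain ⟨δ, hδ, hδ2, hfree, -⟩ := b.exists_free 0
  have hlh := b.lo_lt_hi 0
  set c := b.hi 0 + δ / 2 with hc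
  set η := δ / 4 with hη
  have hη0 : 0 < η := by positivity
  have hηπ : η < π := by linarith
  let ν : C(unitInterval × ℝ, BaseAnnulus) := ⟨fun v => (Circle.exp (c + η * v.2), v.1),
    by fun_prop⟩
  have hangle : ∀ r ∈ Icc (-1 : ℝ) 1, angleAt c (Circle.exp (c + η * r)) = c + η * r := by
    intro r hr
    exact angleAt_exp (by nlinarith [hr.1]) (by nlinarith [hr.2])
  let t : Circle → ℝ := fun z => max (-1) (min 1 ((angleAt c z - c) / η))
  have ht : ∀ r ∈ Icc (-1 : ℝ) 1, t (Circle.exp (c + η * r)) = r := by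
    intro r hr
    simp only [t, hangle r hr, add_sub_cancel_left, mul_div_cancel_left₀ _ hη0.ne']
    rw [min_eq_right hr.2, max_eq_right hr.1]
  let τ : Circle → Circle := fun z => Circle.exp (π * (t z + 1))
  have hτ1 : ∀ z, η < |angleAt c z - c| → τ z = 1 := by
    intro z hz
    rcases lt_abs.1 hz with h | h
    · have : t z = 1 := by
        simp only [t]
        rw [min_eq_left ((one_le_div hη0).2 h.le)]
        norm_num
      simp only [τ, this]
      rw [show π * (1 + 1) = 2 * π by ring, Circle.exp_two_pi]
    · have : t z = -1 := by
        have : (angleAt c z - c) / η ≤ -1 := by rw [div_le_iff₀ hη0]; linarith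
        simp only [t]
        rw [min_eq_right (by linarith), max_eq_left this]
      simp [τ, this]
  -- The angle jumps at the point opposite to `c`, where the rotation is a full turn.
  have hτ : Continuous τ := by
    rw [continuous_iff_continuousAt]
    intro z
    by_cases hz : angleAt c z = c + π
    · have hopen : IsOpen {z | η < |angleAt c z - c|} :=
        isOpen_lt continuous_const (continuous_abs_angleAt_sub c)
      have hmem : z ∈ {z | η < |angleAt c z - c|} := by
        change η < |angleAt c z - c|
        rw [hz, add_sub_cancel_left, abs_of_pos pi_pos]
        exact hηπ
      refine ContinuousAt.congr (f := fun _ => (1 : Circle)) continuousAt_const ?_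
      filter_upwards [hopen.mem_nhds hmem] with w hw using (hτ1 w hw).symm
    · have h1 := continuousAt_angleAt hz
      refine Circle.exp.continuous.continuousAt.comp ?_
      refine continuousAt_const.mul (ContinuousAt.add ?_ continuousAt_const)
      exact continuousAt_const.max (continuousAt_const.min
        ((h1.sub continuousAt_const).div_const _))
  refine ⟨⟨fun s => ν (s, 0), by fun_prop⟩, ⟨fun x => (x.1, τ x.1.1 * x.2), by fun_prop⟩, rfl, rfl,
    ν, ⟨?_, fun s => rfl, ?_, ?_⟩, ?_, ?_⟩
  · rintro ⟨s, r⟩ ⟨-, hr⟩ ⟨s', r'⟩ ⟨-, hr'⟩ h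
    obtain ⟨h1, h2⟩ := Prod.mk.inj h
    have := congrArg (angleAt c) h1
    simp only [hangle r hr, hangle r' hr'] at this
    have : η * r = η * r' := by linarith
    exact Prod.ext h2 (mul_left_cancel₀ hη0.ne' this)
  · intro s r hr
    rfl
  · rintro s r hr ⟨-, h⟩
    refine hfree (c + η * r) ⟨?_, ?_⟩ h
    · nlinarith [hr.1]
    · nlinarith [hr.2]
  · rintro ⟨z, s⟩ hp w
    have : η < |angleAt c z - c| := by
      by_contra! hle
      refine hp ⟨(s, (angleAt c z - c) / η), ⟨mem_univ _, ?_⟩, ?_⟩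
      · rw [abs_le] at hle
        exact ⟨by rw [le_div_iff₀ hη0]; linarith, by rw [div_le_iff₀ hη0]; linarith⟩
      · refine Prod.ext ?_ rfl
        change Circle.exp (c + η * ((angleAt c z - c) / η)) = z
        rw [mul_div_cancel₀ _ hη0.ne', add_sub_cancel, exp_angleAt]
    simp [hτ1 z this]
  · intro s r hr w
    refine Prod.ext rfl ?_
    change τ (Circle.exp (c + η * r)) * w = _
    simp only [τ, ht r hr]

/-- The core circle of the annulus with its standard orientation. -/
theorem isCoreCurve_coreCircle : IsCoreCurve (coreCircle (ContinuousMap.id Circle)) := by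
  refine ⟨fun z w h => (Prod.mk.inj h).1, fun z h => ?_,
    Or.inl (ContinuousMap.Homotopic.refl _)⟩
  rcases h with h | h <;> simp [coreCircle, Subtype.ext_iff] at h

theorem vSweep_isSweep {c A η : ℝ} (hA0 : 0 < A) (hη0 : 0 < η) (hη1 : η < 1 / 2)
    (hAπ : A * (1 + η) < π) (hreg : b.IsRegularNhd (vArc c A η) (vStrip c A η)) :
    b.IsSweep (vArc c A η) unitHalf
      ((basedLoop (coreCircle (ContinuousMap.id Circle)) (Circle.exp c)).cast
        (vArc_half hη0 hη1) (vArc_half hη0 hη1)) (vSweep c A η) := by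
  have hfix := fun p => vSweep_eq_self (c := c) hA0 hη0 hη1 (p := p)
  let t₁ : Path (vStrip c A η (unitHalf, -1)) (vArc c A η unitHalf) :=
    ⟨⟨fun r => vStrip c A η (unitHalf, (r : ℝ) - 1), by fun_prop⟩, by simp, by simp [vArc]⟩
  let t₂ : Path (vArc c A η unitHalf) (vStrip c A η (unitHalf, 1)) :=
    ⟨⟨fun r => vStrip c A η (unitHalf, (r : ℝ)), by fun_prop⟩, by simp [vArc], by simp⟩
  let ht : Path (vStrip c A η (unitHalf, -1)) (vStrip c A η (unitHalf, 1)) :=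
    ⟨⟨fun r => vSweep c A η ((t₁.trans t₂) r), by fun_prop⟩,
      by simpa using hfix _ (hreg.side_notMem unitHalf (Or.inl rfl)),
      by simpa using hfix _ (hreg.side_notMem unitHalf (Or.inr rfl))⟩
  refine ⟨vStrip c A η, hreg, hfix, t₁, t₂, ht, fun _ => rfl, fun _ => rfl, fun _ => rfl,
    homotopic_of_hasWinding (ω := 2 * π) ?_ ?_⟩
  · have hfst : ∀ r, ((t₁.trans t₂) r).1 = Circle.exp c := by
      intro r
      rw [Path.trans_apply]
      split_ifs
      · exact vStrip_half c A η _
      · exact vStrip_half c A η _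
    have hg := continuous_sweepAngle η
    refine ⟨⟨fun r => c + sweepAngle η (vHeight c A ((t₁.trans t₂) r)), by fun_prop⟩,
      fun r => ?_, ?_⟩
    · change Circle.exp (c + sweepAngle η (vHeight c A ((t₁.trans t₂) r))) =
        ((t₁.trans t₂) r).1 * Circle.exp (sweepAngle η (vHeight c A ((t₁.trans t₂) r)))
      rw [hfst, Circle.exp_add]
    · have e0 := vHeight_vStrip (c := c) hA0 hη0 hη1 hAπ unitHalf (r := -1) (by norm_num)
      have e1 := vHeight_vStrip (c := c) hA0 hη0 hη1 hAπ unitHalf (r := 1) (by norm_num)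
      simp only [ContinuousMap.coe_mk, Path.source, Path.target, e0, e1]
      rw [sweepAngle_of_ge (η := η) (t := 1 + η * 1) hη0 (by linarith),
        sweepAngle_of_le (η := η) (t := 1 + η * -1) hη0 (by linarith)]
      ring
  · have w1 : HasWinding (t₁.map continuous_fst) 0 :=
      ⟨ContinuousMap.const _ c, fun r => (vStrip_half c A η _).symm, by simp⟩
    have w2 : HasWinding (t₂.map continuous_fst) 0 :=
      ⟨ContinuousMap.const _ c, fun r => (vStrip_half c A η _).symm, by simp⟩
    have wβ : HasWinding (((basedLoop (coreCircle (ContinuousMap.id Circle)) (Circle.exp c)).cast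
        (vArc_half (A := A) hη0 hη1) (vArc_half (A := A) hη0 hη1)).map continuous_fst) (2 * π) :=
      ⟨⟨fun r => c + 2 * π * r, by fun_prop⟩,
        fun r => (Circle.exp_add c (2 * π * (r : ℝ))), by simp⟩
    rw [Path.map_trans, Path.map_trans]
    simpa using (w1.trans wβ).trans w2

/-- An open interval of angles that avoids `b` and has an end on `bⱼ` lies in a gap adjacent
to `bⱼ`. -/
theorem gap_adjacent_of_Ioo {j : Fin n} {x y e q : ℝ} (hxy : x < y)
    (hf : ∀ t ∈ Ioo x y, Circle.exp t ∉ b.union) (hq : q ∈ Ioo x y) (he : e ∈ Icc x y)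
    (hej : e ∈ Icc (b.lo j) (b.hi j)) :
    (closure (b.gap (Circle.exp q)) ∩ range (b.arc j)).Nonempty := by
  have hsub : Circle.exp '' Ioo x y ⊆ b.gap (Circle.exp q) :=
    (isPreconnected_Ioo.image _ Circle.exp.continuous.continuousOn).subset_connectedComponentIn
      (mem_image_of_mem _ hq) (by rintro _ ⟨t, ht, rfl⟩; exact hf t ht)
  refine ⟨Circle.exp e, closure_mono hsub ?_, b.exp_mem_range_arc j hej⟩
  refine image_closure_subset_closure_image Circle.exp.continuous (mem_image_of_mem _ ?_)
  rwa [closure_Ioo hxy.ne]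

/-- Around each arc of `b`, except for a single one, there is a sweep along the core circle: the
V-shaped arc `ρ = 1` around `bⱼ` touches the core circle at its lowest point. -/
theorem exists_isSweep {j l : Fin n} (hlj : l ≠ j) :
    ∃ (γ : C(unitInterval, BaseAnnulus)) (s : unitInterval) (z : Circle),
      b.IsArcAround j γ ∧
      ∃ hi : γ s = coreCircle (ContinuousMap.id Circle) z,
        range γ ∩ range (coreCircle (ContinuousMap.id Circle)) =
          {coreCircle (ContinuousMap.id Circle) z} ∧
        ∃ h, b.IsSweep γ s
          ((basedLoop (coreCircle (ContinuousMap.id Circle)) z).cast hi hi) h := by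
  obtain ⟨δ, hδ, hδ2, hfree₁, hfree₂⟩ := b.exists_free j
  have hlh := b.lo_lt_hi j
  obtain ⟨c, hc⟩ : ∃ c, c = (b.lo j + b.hi j) / 2 := ⟨_, rfl⟩
  obtain ⟨A, hA⟩ : ∃ A, A = (b.hi j - b.lo j) / 2 + δ / 2 := ⟨_, rfl⟩
  obtain ⟨η, hη⟩ : ∃ η, η = δ / 8 := ⟨_, rfl⟩
  have hδπ : δ < π := by linarith
  have hA0 : 0 < A := by linarith
  have hη0 : 0 < η := by linarith
  have hη1 : η < 1 / 2 := by linarith [pi_lt_four]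
  have hAη : A * η < δ / 2 := by
    have : A < 4 := by linarith [pi_lt_four]
    nlinarith
  have hAπ : A * (1 + η) < π := by nlinarith
  have h0mem : (0 : ℝ) ∈ Icc (-1 : ℝ) 1 := by norm_num
  -- The ends of the strip have free angles.
  have hfree : ∀ x : ℝ, A * (1 - η) ≤ |x - c| → |x - c| ≤ A * (1 + η) →
      Circle.exp x ∉ b.union := by
    intro x h1 h2
    rcases le_abs.1 h1 with h | h
    · have := (abs_le.1 h2).2
      exact hfree₁ x ⟨by nlinarith, by nlinarith⟩
    · have := (abs_le.1 h2).1
      exact hfree₂ x ⟨by nlinarith, by nlinarith⟩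
  have hreg : b.IsRegularNhd (vArc c A η) (vStrip c A η) := by
    refine ⟨vStrip_injOn hA0 hη0 hη1 hAπ, fun _ => rfl,
      fun s r hr => vStrip_mem_bdry_iff hη0 hη1 s hr, ?_⟩
    rintro s r hr ⟨h1, h2⟩
    have hs := abs_fold_eq_one.2 ((vStrip_mem_bdry_iff hη0 hη1 s hr).1 (Or.inr h1))
    obtain ⟨-, h3, h4⟩ := height_bounds hη0 hη1 hr
    have e := abs_vStrip_angle hA0 hη0 hη1 s hr
    rw [hs, mul_one] at e
    refine hfree (c + A * (2 * s - 1) * (1 + η * r)) ?_ ?_ h2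
    · rw [add_sub_cancel_left, e]; gcongr
    · rw [add_sub_cancel_left, e]; gcongr
  have hend : ∀ s : unitInterval, s = 0 ∨ s = 1 → (vArc c A η s).2 = 1 := by
    intro s hs
    apply Subtype.ext
    rw [vArc_snd hη0 hη1, abs_fold_eq_one.2 hs]
    simp
  have hnotu : ∀ s : unitInterval, s = 0 ∨ s = 1 → (vArc c A η s).1 ∉ b.union := fun s hs h =>
    hreg.avoids s 0 h0mem ⟨hend s hs, h⟩
  have hγ0 : (vArc c A η 0).1 = Circle.exp (c - A) := by
    refine (vStrip_fst c A η 0 0).trans (congrArg _ ?_)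
    rw [Icc.coe_zero]
    ring
  have hγ1 : (vArc c A η 1).1 = Circle.exp (c + A) := by
    refine (vStrip_fst c A η 1 0).trans (congrArg _ ?_)
    rw [Icc.coe_one]
    ring
  have harc : b.IsArcAround j (vArc c A η) := by
    refine ⟨fun s s' h => ?_, fun s => vStrip_mem_bdry_iff hη0 hη1 s h0mem,
      ⟨hend 0 (Or.inl rfl), hnotu 0 (Or.inl rfl)⟩,
      ⟨hend 1 (Or.inr rfl), hnotu 1 (Or.inr rfl)⟩, ?_, ?_, ?_⟩
    · exact (Prod.mk.inj (hreg.injOn (mk_mem_prod (mem_univ s) h0mem)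
        (mk_mem_prod (mem_univ s') h0mem) h)).1
    · rw [hγ0]
      exact b.gap_adjacent_of_Ioo (e := b.lo j) (by linarith) hfree₂ ⟨by linarith, by linarith⟩
        ⟨by linarith, by linarith⟩ ⟨by linarith, by linarith⟩
    · rw [hγ1]
      exact b.gap_adjacent_of_Ioo (e := b.hi j) (by linarith) hfree₁ ⟨by linarith, by linarith⟩
        ⟨by linarith, by linarith⟩ ⟨by linarith, by linarith⟩
    · -- Otherwise the gap would contain the other arc `bₗ`.
      intro heq
      have hzl : b.arc l 0 ∈ range (b.arc l) := ⟨0, rfl⟩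
      generalize b.arc l 0 = z at hzl
      have hzu := b.range_arc_subset l hzl
      have hzm := b.coangle_mem j (Set.disjoint_left.1 (b.arc_disjoint l j hlj) hzl)
      have hz1 : c + A ≤ b.coangle j z := by
        by_contra! hlt
        exact hfree₁ _ ⟨hzm.1, by linarith⟩ (by rwa [exp_coangle])
      have hz2 : b.coangle j z ≤ c - A + 2 * π := by
        by_contra! hlt
        refine hfree₂ (b.coangle j z - 2 * π) ⟨by linarith, by linarith [hzm.2]⟩ ?_
        rwa [Circle.exp_sub_two_pi, exp_coangle]
      have e0 : b.coangle j (vArc c A η 0).1 = c - A + 2 * π := by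
        rw [hγ0, ← Circle.exp_add_two_pi]
        exact b.coangle_exp j ⟨by linarith, by linarith⟩
      have e1 : b.coangle j (vArc c A η 1).1 = c + A := by
        rw [hγ1]
        exact b.coangle_exp j ⟨by linarith, by linarith⟩
      have hmem := b.exp_mem_of_isPreconnected j (b.isPreconnected_gap (vArc c A η 0).1)
        (b.disjoint_gap j _)
        (z := (vArc c A η 1).1) (z' := (vArc c A η 0).1) (y := b.coangle j z)
        (heq ▸ mem_connectedComponentIn (hnotu 1 (Or.inr rfl)))
        (mem_connectedComponentIn (hnotu 0 (Or.inl rfl))) (by rwa [e1]) (by rwa [e0])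
      rw [exp_coangle] at hmem
      exact b.gap_subset _ hmem hzu
  exact ⟨vArc c A η, unitHalf, Circle.exp c, harc, vArc_half hη0 hη1, range_vArc_inter hη0 hη1,
    vSweep c A η, b.vSweep_isSweep hA0 hη0 hη1 hAπ hreg⟩

theorem exists_sweepSystem {m : ℕ} (b : BoundaryArcs (m + 1)) : Nonempty (SweepSystem b) := by
  have h := fun j : Fin m => b.exists_isSweep (j := j.castSucc) (l := Fin.last m)
    (Fin.castSucc_lt_last j).ne'
  choose γ s z harc hpt hinter h hsweep using h
  exact ⟨⟨coreCircle (ContinuousMap.id Circle), isCoreCurve_coreCircle, γ, harc, s, z, hpt, hinter,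
    h, hsweep⟩⟩

end BoundaryArcs

/-! ### The group `E(T, Fr(T))` -/

namespace BoundaryArcs

variable {n : ℕ} {b : BoundaryArcs n} {T : Type*} [TopologicalSpace T]
  {Φ : T ≃ₜ BaseAnnulus × Circle} {A : Set T}

/-- A map of `B × S¹` that fixes `b × S¹` pointwise defines the class of `E(T, A)` that has its
invariants. -/
theorem isClassOf_of_invariants [LocallyCompactSpace T] (hA : ∀ x, x ∈ A ↔ Φ x ∈ b.thick)
    {f : C(BaseAnnulus × Circle, BaseAnnulus × Circle)} (hfix : ∀ x ∈ b.thick, f x = x)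
    {k : ℤ} {u : Fin n → ℤ} (hf : b.HasInvariants f 1 k u) {x : PairMappingClasses T A}
    (hx : ClassHasInvariants (PairMappingClasses.congr Φ hA x) 1 k u) :
    PairMappingClasses.IsClassOf x (transportMap Φ f) := by
  have h1 : IsSelfHomotopyEquiv (transportMap Φ f) :=
    (hf.isSelfHomotopyEquiv (one_mul 1)).conjMap Φ.symm
  have h2 : RestrictsToIsotopicId A (transportMap Φ f) :=
    restrictsToIsotopicId_of_fixing fun x hx => by
      simp [transportMap, hfix _ ((hA x).1 hx)]
  refine ⟨⟨h1, h2⟩, (PairMappingClasses.congr Φ hA).injective (hx.eq ?_ 0 (u' := u) (by simp))⟩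
  rw [PairMappingClasses.congr_mk, classHasInvariants_mk]
  convert hf using 1
  exact conjMap_conjMap_symm Φ.symm f

/-- A map induces the identity on `π₁(B)` if and only if its class has degree `p = 1` over the
base. -/
theorem inducesIdOnLoops_baseMap_iff (hA : ∀ x, x ∈ A ↔ Φ x ∈ b.thick) (f : PairEquivSpace T A)
    {p k : ℤ} {u : Fin n → ℤ} (hf : b.HasInvariants (PairEquivSpace.conj Φ hA f).1 p k u) :
    InducesIdOnLoops (baseMap Φ f.1) ↔ p = 1 := by
  obtain ⟨θ, -, h1, -⟩ := hf
  exact inducesIdOnLoops_iff (θ := θ.comp ⟨fun x => (x, 1), by fun_prop⟩) fun x => h1 (x, 1)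

end BoundaryArcs

theorem proposition3p4 {M : Type*} [TopologicalSpace M] [T2Space M]
    (T : Set M) [CompactSpace T] {m : ℕ} (b : BoundaryArcs (m + 1))
    (Φ : T ≃ₜ BaseAnnulus × Circle)
    (hΦ : ∀ x : T, x ∈ frontierIn T ↔ (Φ x).1 ∈ b.carrier) :
    -- `E(T, Fr(T))` is a group
    (∀ x : PairMappingClasses T (frontierIn T), IsUnit x) ∧
    -- generating systems of sweeps and Dehn twists about vertical essential annuli exist
    Nonempty (SweepSystem b) ∧ (∃ a D, IsVerticalDehnTwist b a D) ∧
    ∃ E₀ : Subgroup (PairMappingClasses T (frontierIn T))ˣ,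
      E₀.index = 2 ∧
      -- `E₀` consists of the classes whose base map induces the identity on `π₁(B)`
      (∀ (u : (PairMappingClasses T (frontierIn T))ˣ) (f : PairEquivSpace T (frontierIn T)),
        (u : PairMappingClasses T (frontierIn T)) = PairMappingClasses.mk f →
          (u ∈ E₀ ↔ InducesIdOnLoops (baseMap Φ f.1))) ∧
      -- `E₀` is free abelian, with the sweeps and the Dehn twist as a basis
      ∀ (S : SweepSystem b) (a : C(unitInterval, BaseAnnulus))
        (D : C(BaseAnnulus × Circle, BaseAnnulus × Circle)), IsVerticalDehnTwist b a D →
        ∃ φ : Multiplicative (Fin (m + 1) → ℤ) ≃* E₀,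
          (∀ j : Fin m, PairMappingClasses.IsClassOf
            ((φ (Multiplicative.ofAdd (Pi.single j.castSucc 1)) :
              (PairMappingClasses T (frontierIn T))ˣ) : PairMappingClasses T (frontierIn T))
            (thickenedSweep Φ (S.h j))) ∧
          PairMappingClasses.IsClassOf
            ((φ (Multiplicative.ofAdd (Pi.single (Fin.last m) 1)) :
              (PairMappingClasses T (frontierIn T))ˣ) : PairMappingClasses T (frontierIn T))
            (transportMap Φ D) := by
  have hA : ∀ x, x ∈ frontierIn T ↔ Φ x ∈ b.thick := hΦ
  let ε := PairMappingClasses.congr Φ hA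
  obtain ⟨E₀, hindex, hmem, hbasis⟩ := BoundaryArcs.exists_subgroup (b := b) ε
  refine ⟨fun x => ?_, b.exists_sweepSystem, b.exists_isVerticalDehnTwist, E₀, hindex, ?_, ?_⟩
  · have h := (BoundaryArcs.isUnit_class (ε x)).map ε.symm
    rwa [MulEquiv.symm_apply_apply] at h
  · intro v f hv
    obtain ⟨p, k, u, -, hf⟩ := BoundaryArcs.exists_hasInvariants (b := b)
      (PairEquivSpace.conj Φ hA f).2.1 (PairEquivSpace.conj Φ hA f).2.2
    rw [BoundaryArcs.inducesIdOnLoops_baseMap_iff hA f hf]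
    refine hmem v p k u ?_
    rw [hv]
    exact BoundaryArcs.classHasInvariants_mk.2 hf
  · intro S a D hD
    have hsweep : ∀ j : Fin m, ∃ σ : ℤ, σ * σ = 1 ∧
        b.HasInvariants ((S.h j).prodMap (ContinuousMap.id Circle)) 1 0
          (fun i => if i = j.castSucc then σ else 0) := by
      intro j
      obtain ⟨ω, hω, hβ⟩ := S.isCoreCurve.hasWinding (S.z j)
      refine (S.isSweep j).exists_hasInvariants (S.isArcAround j) hω ?_
      obtain ⟨l, h1, h2⟩ := hβ
      exact ⟨l, h1, h2⟩
    choose σ hσ hinv using hsweep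
    obtain ⟨hfix, τ, hτ, hinvD⟩ := hD.exists_hasInvariants
    obtain ⟨φ, hφ⟩ := hbasis (Fin.snoc (α := fun _ => ℤ) σ τ) fun j => by
      refine Fin.lastCases ?_ (fun i => ?_) j
      · simpa using hτ
      · simpa using hσ i
    refine ⟨φ, fun j => ?_, ?_⟩
    · refine BoundaryArcs.isClassOf_of_invariants hA (fun x hx => ?_) (hinv j) ?_
      · exact Prod.ext ((S.isSweep j).eq_of_mem_carrier hx) rfl
      · convert hφ (Pi.single j.castSucc 1) using 1
        · simp [Fin.castSucc_ne_last j |>.symm]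
        · funext i
          refine Fin.lastCases ?_ (fun i => ?_) i
          · simp [Fin.castSucc_ne_last j |>.symm]
          · by_cases h : i = j
            · subst h; simp [Fin.castSucc_ne_last]
            · simp [h, Fin.castSucc_ne_last]
    · refine BoundaryArcs.isClassOf_of_invariants hA hfix hinvD ?_
      convert hφ (Pi.single (Fin.last m) 1) using 1
      · simp
      · funext i
        by_cases h : i = Fin.last m <;> simp [h]
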